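/- **Setting.** Let $k\ge 1$, $t\ge 3k$ (the paper takes $k=t/3$) and $n\ge 3t+1$ be integers. There are $n$ nodes; a set $\mathcal F$ of at most $t$ of them is dishonest and behaves arbitrarily. Any two honest nodes are joined by an asynchronous authenticated channel: every message between honest nodes is eventually received, after an arbitrary finite delay. Messages are elements of $\Sigma^k$. An $(n,k)$ error correction code over $\Sigma$ is fixed (for instance a Reed–Solomon code): an encoder $w\mapsto(y_1(w),\dots,y_n(w))\in\Sigma^n$ and a decoder that returns $w$ from any $m\le n$ observed symbols at most $e$ of which differ from the encoding of $w$, whenever $2e+k\le m$. An honest node handles each event (a received message, an initial message, an output of the binary agreement) completely, in the sense that it executes enabled "upon" clauses until none is enabled, before it turns to the next event. It stops when it outputs. "Send" without addressee means: to all nodes, itself included. **$\mathrm{UA}[p]$, $p\in\{1,2\}$, at node $i$.** On input $w$, send $(\mathrm{SYMBOL},p,(y_j(w),y_i(w)))$ to each node $j$. Only the first SYMBOL, first SI1 and first SI2 message of instance $p$ from each node counts. A received pair $(a,b)$ from $j$ is delivered to the main protocol; once node $i$ has an input $w$, put $j$ in $L_1$ if $(a,b)=(y_i(w),y_j(w))$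 and in $L_0$ otherwise. $S^{[q]}_b$ ($q=1,2$) is the set of nodes from which $\mathrm{SI}q$ was received with value $b$. Initially $s^{[1]},s^{[2]},v$ are empty. While $s^{[1]}$ is empty: if $|L_1|\ge n-t$ set $s^{[1]}=1$, if $|L_0|\ge t+1$ set $s^{[1]}=0$; send it in an SI1 message. While $s^{[2]}$ is empty: if $s^{[1]}=0$ or $|S^{[1]}_0\cup L_0|\ge t+1$ set $s^{[2]}=0$, if $s^{[1]}=1$ and $|S^{[1]}_1\cap L_1|\ge n-t$ set $s^{[2]}=1$; send it in an SI2 message. If $|S^{[2]}_1|\ge n-t$ set the vote $v=1$; if $|S^{[2]}_0|\ge t+1$ set $v=0$. **OciorACOOL at node $i$.** 1. An initial message $w_i$ is passed into $\mathrm{UA}[1]$. 2. If at least $n-2t$ nodes sent $y$ as the first component of their $\mathrm{UA}[1]$ symbol pair, these nodes together with $S^{[2]}_0$ of $\mathrm{UA}[1]$ are at least $n-t$ nodes, and $s^{[1]}\ne1$ in $\mathrm{UA}[1]$, then send $(\mathrm{NEWSYMBOL},y)$ (once). For each $j$ collect one symbol: the one in the NEWSYMBOL message from $j$, or the second component of the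 $\mathrm{UA}[1]$ pair of $j$ if $j\in S^{[1]}_1$ in $\mathrm{UA}[1]$, whichever comes first. After each new symbol, until success, if at least $k+t$ symbols are collected, decode; if at least $k+t$ collected symbols match the re-encoding, the decoded message becomes the candidate $\tilde w_i$. 3. If $\mathrm{UA}[2]$ has no input yet: if $s^{[2]}=1$ in $\mathrm{UA}[1]$, set $\tilde w_i=w_i$ and pass it into $\mathrm{UA}[2]$; if $\tilde w_i$ is non-empty, pass it into $\mathrm{UA}[2]$. 4. If nothing has been passed into the asynchronous binary agreement (ABBA) yet: pass in $v$ of $\mathrm{UA}[2]$ once it is set; pass in $0$ if $v=0$ or $s^{[2]}=0$ in $\mathrm{UA}[1]$. 5. When ABBA outputs $b$, send $(\mathrm{READY},b)$. On $t+1$ messages $(\mathrm{READY},v)$ from different nodes with no READY message sent yet, send $(\mathrm{READY},v)$. On $2t+1$ messages $(\mathrm{READY},v)$ from different nodes: if $v=0$, output the default value $\bot$; if $v=1$, go to step 6. 6. If $v$ is set and $s^{[2]}=1$ in $\mathrm{UA}[2]$, output the input of $\mathrm{UA}[2]$. Otherwise wait until at least $t+1$ nodes of $S^{[2]}_1$ of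 $\mathrm{UA}[2]$ have sent the same first component $y$ in their $\mathrm{UA}[2]$ pair, send $(\mathrm{CORRECTSYMBOL},y)$, wait for the success of step 7, and output the message decoded there. 7. From the start, collect for each $j$ one symbol: the one in the CORRECTSYMBOL message from $j$, or the second component of the $\mathrm{UA}[2]$ pair of $j$ if $j\in S^{[2]}_1$ in $\mathrm{UA}[2]$, whichever comes first; decode as in step 2. **Assumption on ABBA.** Two honest nodes never obtain different values from ABBA (consistency), and a value obtained by an honest node has been passed in by some honest node before (validity). Neither termination nor totality is assumed. **Theorem (Consistency).** In every execution of OciorACOOL, if one honest node outputs a value $w^\star$ (a message or $\bot$), then every honest node eventually outputs the same $w^\star$. -/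

import Mathlib

namespace ACOOL

/-! ## Error correction codes -/

/-- An `(n, k)` error correction code over the alphabet `α`.  A word with erasures is a map
`y : Fin n → Option α` (`none` = not observed).  The decoder corrects `e` errors among `m` observed
symbols whenever `2 * e + k ≤ m`; outside this radius its answer is arbitrary. -/
structure ErrorCorrectingCode (n k : ℕ) (α : Type*) where
  enc : (Fin k → α) → Fin n → α
  dec : (Fin n → Option α) → (Fin k → α)
  dec_correct : ∀ (w : Fin k → α) (y : Fin n → Option α),
    2 * {j | ∃ a, y j = some a ∧ a ≠ enc w j}.ncard + k ≤ {j | y j ≠ none}.ncard → dec y = w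

/-- Reed-Solomon encoding: evaluation at distinct points of the polynomial with coefficients `w`. -/
def rsEnc {n k : ℕ} {K : Type*} [Field K] (pt : Fin n ↪ K) (w : Fin k → K) (j : Fin n) : K :=
  ∑ i : Fin k, pt j ^ (i : ℕ) * w i

theorem rsEnc_unique {n k : ℕ} {K : Type*} [Field K] (pt : Fin n ↪ K) (w w' : Fin k → K)
    (h : k ≤ {j | rsEnc pt w j = rsEnc pt w' j}.ncard) : w = w' := by
  classical
  rw [Set.ncard_eq_toFinset_card'] at h
  obtain ⟨s, hs, hc⟩ := Finset.exists_subset_card_eq h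
  have key := Matrix.eq_zero_of_forall_index_sum_pow_mul_eq_zero
    (f := fun i : Fin k => pt (s.orderEmbOfFin hc i)) (v := fun i => w i - w' i)
    (pt.injective.comp (s.orderEmbOfFin hc).injective) (by
      intro j
      have hj : rsEnc pt w (s.orderEmbOfFin hc j) = rsEnc pt w' (s.orderEmbOfFin hc j) := by
        simpa using hs (s.orderEmbOfFin_mem hc j)
      simp only [rsEnc] at hj
      simp only [mul_sub, Finset.sum_sub_distrib, hj, sub_self])
  funext i
  exact sub_eq_zero.mp (congrFun key i)

open Classical in
/-- Reed-Solomon codes, with unique decoding, are codes in the sense above (for every field with at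
least `n` elements). -/
noncomputable def reedSolomon {n k : ℕ} {K : Type*} [Field K] (pt : Fin n ↪ K) :
    ErrorCorrectingCode n k K where
  enc := rsEnc pt
  dec y := if h : ∃ w : Fin k → K,
      2 * {j | ∃ a, y j = some a ∧ a ≠ rsEnc pt w j}.ncard + k ≤ {j | y j ≠ none}.ncard
    then h.choose else 0
  dec_correct w y hw := by
    have h : ∃ w : Fin k → K,
      2 * {j | ∃ a, y j = some a ∧ a ≠ rsEnc pt w j}.ncard + k ≤ {j | y j ≠ none}.ncard := ⟨w, hw⟩
    rw [dif_pos h]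
    have h' := h.choose_spec
    apply rsEnc_unique pt
    generalize h.choose = w' at h'
    have hsub : {j | y j ≠ none} ⊆ ({j | ∃ a, y j = some a ∧ a ≠ rsEnc pt w j} ∪
        {j | ∃ a, y j = some a ∧ a ≠ rsEnc pt w' j}) ∪ {j | rsEnc pt w' j = rsEnc pt w j} := by
      intro j hj
      obtain ⟨a, ha⟩ := Option.ne_none_iff_exists'.mp hj
      by_cases h1 : a = rsEnc pt w j
      · by_cases h2 : a = rsEnc pt w' j
        · right; exact h2.symm.trans h1
        · left; right; exact ⟨a, ha, h2⟩
      · left; left; exact ⟨a, ha, h1⟩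
    have h1 := Set.ncard_le_ncard hsub (Set.toFinite _)
    have h2 := Set.ncard_union_le ({j | ∃ a, y j = some a ∧ a ≠ rsEnc pt w j} ∪
        {j | ∃ a, y j = some a ∧ a ≠ rsEnc pt w' j}) {j | rsEnc pt w' j = rsEnc pt w j}
    have h3 := Set.ncard_union_le {j | ∃ a, y j = some a ∧ a ≠ rsEnc pt w j}
        {j | ∃ a, y j = some a ∧ a ≠ rsEnc pt w' j}
    omega

/-! ## Messages and local states -/

/-- The two instances of the unique agreement protocol `COOL-UA`. -/
inductive Inst
  | one
  | two
  deriving DecidableEq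

/-- Messages of the protocol. `symbol p a b` is the message `(SYMBOL, p, (a, b))`. -/
inductive Msg (α : Type*)
  | symbol (p : Inst) (a b : α)
  | si1 (p : Inst) (b : Bool)
  | si2 (p : Inst) (b : Bool)
  | newSymbol (y : α)
  | ready (v : Bool)
  | correctSymbol (y : α)

/-- Local state of one node in one instance of `COOL-UA`. -/
@[ext] structure UAState (n k : ℕ) (α : Type*) where
  /-- input message `w⁽ⁱ⁾` (once it is present, it has been encoded and the symbols are sent) -/
  inp : Option (Fin k → α)
  /-- success indicators of Phases 1 and 2 -/
  s1 : Option Bool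
  s2 : Option Bool
  /-- vote; it is set exactly when the triple `[w⁽ⁱ⁾, s2, v]` is delivered -/
  v : Option Bool
  /-- first pair `(y_i⁽ʲ⁾, y_j⁽ʲ⁾)` received from node `j`; it is delivered to the invoking protocol
  upon receipt, while the comparison with the own symbols waits until these exist (see `link1`) -/
  sym : Fin n → Option (α × α)
  /-- first Phase 1 and Phase 2 indicators received from node `j` -/
  si1 : Fin n → Option Bool
  si2 : Fin n → Option Bool

/-- Local state of one node in the whole protocol. -/
@[ext] structure NodeState (n k : ℕ) (α : Type*) where
  /-- initial message -/
  input : Option (Fin k → α)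
  ua : Inst → UAState n k α
  /-- candidate input for the second instance, and whether online decoding has produced it -/
  cand : Option (Fin k → α)
  oecNew : Bool
  /-- symbols collected for the first online decoding -/
  symNew : Fin n → Option α
  /-- the strong-majority symbol -/
  strong : Option α
  abbaIn : Option Bool
  abbaOut : Option Bool
  /-- values `v` for which this node has sent `READY v` -/
  readySent : Finset Bool
  /-- nodes from which `READY v` has been received -/
  ready : Bool → Finset (Fin n)
  vOut : Option Bool
  /-- has taken the "else" branch of the multicast phase -/
  waiting : Bool
  correctSent : Bool
  /-- symbols collected for the final online decoding, its success flag and its result -/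
  symFin : Fin n → Option α
  oecFin : Bool
  decoded : Option (Fin k → α)
  /-- `none`: no output yet; `some none`: output `⊥`; `some (some w)`: output `w`.
  A node terminates when it outputs. -/
  output : Option (Option (Fin k → α))

def UAState.init (n k : ℕ) (α : Type*) : UAState n k α where
  inp := none
  s1 := none
  s2 := none
  v := none
  sym _ := none
  si1 _ := none
  si2 _ := none

def NodeState.init (n k : ℕ) (α : Type*) : NodeState n k α where
  input := none
  ua _ := UAState.init n k α
  cand := none
  oecNew := false
  symNew _ := none
  strong := none
  abbaIn := none
  abbaOut := none
  readySent := ∅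
  ready _ := ∅
  vOut := none
  waiting := false
  correctSent := false
  symFin _ := none
  oecFin := false
  decoded := none
  output := none

section Protocol

variable {n k : ℕ} {α : Type*}

/-- Replace the state of instance `p`. -/
def NodeState.setUA (s : NodeState n k α) (p : Inst) (u : UAState n k α) : NodeState n k α :=
  { s with ua := Function.update s.ua p u }

/-! ### Sets derived from what node `i` has received in one instance of `COOL-UA` -/

/-- Link set `L₁`: both symbols received from `j` match the own ones. -/
def UAState.link1 (C : ErrorCorrectingCode n k α) (i : Fin n) (u : UAState n k α) : Set (Fin n) :=
  {j | ∃ w a b, u.inp = some w ∧ u.sym j = some (a, b) ∧ (a = C.enc w i ∧ b = C.enc w j)}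

/-- Link set `L₀`: the symbols received from `j` do not both match the own ones. -/
def UAState.link0 (C : ErrorCorrectingCode n k α) (i : Fin n) (u : UAState n k α) : Set (Fin n) :=
  {j | ∃ w a b, u.inp = some w ∧ u.sym j = some (a, b) ∧ ¬ (a = C.enc w i ∧ b = C.enc w j)}

/-- Nodes whose Phase 1 (resp. Phase 2) indicator was received with value `b`. -/
def UAState.set1 (u : UAState n k α) (b : Bool) : Set (Fin n) := {j | u.si1 j = some b}
def UAState.set2 (u : UAState n k α) (b : Bool) : Set (Fin n) := {j | u.si2 j = some b}

/-- Nodes `j` that sent `y` as the own (that is, the `i`-th) symbol of the receiving node `i`. -/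
def UAState.votes (u : UAState n k α) (y : α) : Set (Fin n) := {j | ∃ b, u.sym j = some (y, b)}

/-! ### Online error correction -/

/-- One attempt succeeds on the collected symbols `y`: at least `k + t` of them are present, and at
least `k + t` of them match the re-encoding of the decoded message. -/
def OECSucceeds (C : ErrorCorrectingCode n k α) (t : ℕ) (y : Fin n → Option α) : Prop :=
  k + t ≤ {j | y j ≠ none}.ncard ∧ k + t ≤ {j | y j = some (C.enc (C.dec y) j)}.ncard

open Classical in
/-- Record `y` as the symbol of node `j` and make a decoding attempt (first online decoding). -/
noncomputable def NodeState.addNew (C : ErrorCorrectingCode n k α) (t : ℕ) (s : NodeState n k α)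
    (j : Fin n) (y : α) : NodeState n k α :=
  let c := Function.update s.symNew j (some y)
  if s.oecNew = false ∧ OECSucceeds C t c then
    { s with symNew := c, cand := some (C.dec c), oecNew := true }
  else { s with symNew := c }

open Classical in
/-- Record `y` as the symbol of node `j` and make a decoding attempt (final online decoding). -/
noncomputable def NodeState.addFin (C : ErrorCorrectingCode n k α) (t : ℕ) (s : NodeState n k α)
    (j : Fin n) (y : α) : NodeState n k α :=
  let c := Function.update s.symFin j (some y)
  if OECSucceeds C t c then
    { s with symFin := c, decoded := some (C.dec c), oecFin := true }
  else { s with symFin := c }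

/-! ### Passing an input to an instance of `COOL-UA` -/

def NodeState.passUA (s : NodeState n k α) (p : Inst) (w : Fin k → α) : NodeState n k α :=
  s.setUA p { s.ua p with inp := some w }

/-- The symbol messages of node `i` with input `w`: node `j` gets `(y_j⁽ⁱ⁾, y_i⁽ⁱ⁾)`. -/
def symbolMsgs (C : ErrorCorrectingCode n k α) (i : Fin n) (p : Inst) (w : Fin k → α) :
    Fin n → Msg α :=
  fun j => .symbol p (C.enc w j) (C.enc w i)

/-! ### The "upon" clauses that react to the local state

`Clause C t i s out s'`: node `i` executes one enabled clause in state `s`; afterwards its state is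
`s'`. If `out = some f` then it sends `f j` to every node `j` (itself included); if `out = none` it
sends nothing. -/
inductive Clause (C : ErrorCorrectingCode n k α) (t : ℕ) (i : Fin n) :
    NodeState n k α → Option (Fin n → Msg α) → NodeState n k α → Prop
  -- `COOL-UA`, instance `p`
  | s1One (s : NodeState n k α) (p : Inst) (h : s.output = none)
      (hL : n - t ≤ ((s.ua p).link1 C i).ncard) (hs : (s.ua p).s1 = none) :
      Clause C t i s (some fun _ => .si1 p true) (s.setUA p { s.ua p with s1 := some true })
  | s1Zero (s : NodeState n k α) (p : Inst) (h : s.output = none)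
      (hL : t + 1 ≤ ((s.ua p).link0 C i).ncard) (hs : (s.ua p).s1 = none) :
      Clause C t i s (some fun _ => .si1 p false) (s.setUA p { s.ua p with s1 := some false })
  | s2Zero (s : NodeState n k α) (p : Inst) (h : s.output = none)
      (hc : (s.ua p).s1 = some false ∨
        t + 1 ≤ ((s.ua p).set1 false ∪ (s.ua p).link0 C i).ncard)
      (hs : (s.ua p).s2 = none) :
      Clause C t i s (some fun _ => .si2 p false) (s.setUA p { s.ua p with s2 := some false })
  | s2One (s : NodeState n k α) (p : Inst) (h : s.output = none)
      (h1 : (s.ua p).s1 = some true)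
      (hc : n - t ≤ ((s.ua p).set1 true ∩ (s.ua p).link1 C i).ncard)
      (hs : (s.ua p).s2 = none) :
      Clause C t i s (some fun _ => .si2 p true) (s.setUA p { s.ua p with s2 := some true })
  | voteOne (s : NodeState n k α) (p : Inst) (h : s.output = none)
      (hc : n - t ≤ ((s.ua p).set2 true).ncard) (hv : (s.ua p).v ≠ some true) :
      Clause C t i s none (s.setUA p { s.ua p with v := some true })
  | voteZero (s : NodeState n k α) (p : Inst) (h : s.output = none)
      (hc : t + 1 ≤ ((s.ua p).set2 false).ncard) (hv : (s.ua p).v ≠ some false) :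
      Clause C t i s none (s.setUA p { s.ua p with v := some false })
  -- setting the input of the second instance
  | collectNew (s : NodeState n k α) (j : Fin n) (a y : α) (h : s.output = none)
      (hy : (s.ua .one).sym j = some (a, y)) (hj : j ∈ (s.ua .one).set1 true)
      (hn : s.symNew j = none) :
      Clause C t i s none (s.addNew C t j y)
  | strongMajority (s : NodeState n k α) (y : α) (h : s.output = none)
      (h1 : n - t ≤ ((s.ua .one).votes y ∪ (s.ua .one).set2 false).ncard)
      (h2 : n - 2 * t ≤ ((s.ua .one).votes y).ncard)
      (h3 : (s.ua .one).s1 ≠ some true) (h4 : s.strong = none) :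
      Clause C t i s (some fun _ => .newSymbol y) { s with strong := some y }
  | passOwn (s : NodeState n k α) (w : Fin k → α) (h : s.output = none)
      (h2 : (s.ua .one).s2 = some true) (hw : s.input = some w)
      (hn : (s.ua .two).inp = none) :
      Clause C t i s (some (symbolMsgs C i .two w))
        ({ s with cand := some w } |>.passUA .two w)
  | passCand (s : NodeState n k α) (w : Fin k → α) (h : s.output = none)
      (hw : s.cand = some w) (hn : (s.ua .two).inp = none) :
      Clause C t i s (some (symbolMsgs C i .two w)) (s.passUA .two w)
  -- input to the binary agreement
  | abbaVote (s : NodeState n k α) (b : Bool) (h : s.output = none)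
      (hv : (s.ua .two).v = some b) (ha : s.abbaIn = none) :
      Clause C t i s none { s with abbaIn := some b }
  | abbaZero (s : NodeState n k α) (h : s.output = none)
      (hv : (s.ua .one).v = some false ∨ (s.ua .one).s2 = some false) (ha : s.abbaIn = none) :
      Clause C t i s none { s with abbaIn := some false }
  -- binary reliable agreement
  | readyAmplify (s : NodeState n k α) (v : Bool) (h : s.output = none)
      (hr : t + 1 ≤ (s.ready v).card) (hs : s.readySent = ∅) :
      Clause C t i s (some fun _ => .ready v) { s with readySent := {v} }
  | setZero (s : NodeState n k α) (h : s.output = none)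
      (hr : 2 * t + 1 ≤ (s.ready false).card) (hv : s.vOut = none) :
      Clause C t i s none { s with vOut := some false, output := some none }
  | setOne (s : NodeState n k α) (h : s.output = none)
      (hr : 2 * t + 1 ≤ (s.ready true).card) (hv : s.vOut = none) :
      Clause C t i s none { s with vOut := some true }
  -- multicast phase
  | outputOwn (s : NodeState n k α) (h : s.output = none) (hv : s.vOut = some true)
      (hw : s.waiting = false) (hd : (s.ua .two).v ≠ none) (h2 : (s.ua .two).s2 = some true) :
      Clause C t i s none { s with output := some (s.ua .two).inp }
  | enterWait (s : NodeState n k α) (h : s.output = none) (hv : s.vOut = some true)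
      (hw : s.waiting = false) (hd : ¬ ((s.ua .two).v ≠ none ∧ (s.ua .two).s2 = some true)) :
      Clause C t i s none { s with waiting := true }
  | correct (s : NodeState n k α) (y : α) (h : s.output = none) (hw : s.waiting = true)
      (hc : s.correctSent = false)
      (hy : t + 1 ≤ ((s.ua .two).votes y ∩ (s.ua .two).set2 true).ncard) :
      Clause C t i s (some fun _ => .correctSymbol y) { s with correctSent := true }
  | outputDecoded (s : NodeState n k α) (h : s.output = none) (hc : s.correctSent = true)
      (hf : s.oecFin = true) :
      Clause C t i s none { s with output := some s.decoded }
  | collectFin (s : NodeState n k α) (j : Fin n) (a y : α) (h : s.output = none)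
      (hy : (s.ua .two).sym j = some (a, y)) (hj : j ∈ (s.ua .two).set2 true)
      (hn : s.symFin j = none) (hf : s.oecFin = false) :
      Clause C t i s none (s.addFin C t j y)

/-- No clause is enabled: the node has finished processing and waits for the next event. -/
def Quiescent (C : ErrorCorrectingCode n k α) (t : ℕ) (i : Fin n) (s : NodeState n k α) : Prop :=
  ∀ out s', ¬ Clause C t i s out s'

/-! ### Reception of a message -/

open Classical in
/-- State of a node after receiving a message from node `j`. Repeated messages of a kind from the
same node are ignored. A terminated node ignores everything. -/
noncomputable def NodeState.receive (C : ErrorCorrectingCode n k α) (t : ℕ) (s : NodeState n k α)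
    (j : Fin n) (m : Msg α) : NodeState n k α :=
  if s.output ≠ none then s else
  match m with
  | .symbol p a b =>
      if (s.ua p).sym j = none then
        s.setUA p { s.ua p with sym := Function.update (s.ua p).sym j (some (a, b)) }
      else s
  | .si1 p b =>
      if (s.ua p).si1 j = none then
        s.setUA p { s.ua p with si1 := Function.update (s.ua p).si1 j (some b) }
      else s
  | .si2 p b =>
      if (s.ua p).si2 j = none then
        s.setUA p { s.ua p with si2 := Function.update (s.ua p).si2 j (some b) }
      else s
  | .newSymbol y => if s.symNew j = none then s.addNew C t j y else s
  | .ready v => { s with ready := Function.update s.ready v (insert j (s.ready v)) }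
  | .correctSymbol y =>
      if s.symFin j = none ∧ s.oecFin = false then s.addFin C t j y else s

/-! ## Asynchronous executions with Byzantine nodes -/

/-- Global configuration: the local states, and the multiset of the messages
`(sender, receiver, message)` that are in transit. -/
structure Config (n k : ℕ) (α : Type*) where
  node : Fin n → NodeState n k α
  net : Multiset (Fin n × Fin n × Msg α)

def Config.init (n k : ℕ) (α : Type*) : Config n k α where
  node _ := NodeState.init n k α
  net := 0

/-- Events of an execution. -/
inductive Event (n k : ℕ) (α : Type*)
  /-- honest node `i` executes one enabled clause -/
  | act (i : Fin n)
  /-- honest node `dst` receives a message that is in transit -/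
  | recv (src dst : Fin n) (m : Msg α)
  /-- honest node `i` gets its initial message -/
  | input (i : Fin n) (w : Fin k → α)
  /-- the binary agreement outputs `b` at honest node `i` -/
  | abba (i : Fin n) (b : Bool)
  /-- a dishonest node sends an arbitrary message -/
  | byz (src dst : Fin n) (m : Msg α)
  | idle

/-- The messages in transit when node `i` sends `f j` to every node `j`. -/
def sends (i : Fin n) (out : Option (Fin n → Msg α)) : Multiset (Fin n × Fin n × Msg α) :=
  match out with
  | none => 0
  | some f => Finset.univ.val.map fun j => (i, j, f j)

/-- Change the state of node `i` to `s`. -/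
def Config.setNode (c : Config n k α) (i : Fin n) (s : NodeState n k α)
    (net : Multiset (Fin n × Fin n × Msg α)) : Config n k α where
  node := Function.update c.node i s
  net := net

/-- Transitions. `F` is the set of dishonest nodes. An honest node handles an event completely
(until no clause is enabled) before it turns to the next one. Nodes know the true sender of what
they receive. -/
inductive Step (C : ErrorCorrectingCode n k α) (t : ℕ) (F : Finset (Fin n)) :
    Config n k α → Event n k α → Config n k α → Prop
  | act (c : Config n k α) (i : Fin n) (out : Option (Fin n → Msg α)) (s' : NodeState n k α)
      (hi : i ∉ F) (hc : Clause C t i (c.node i) out s') :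
      Step C t F c (.act i) (c.setNode i s' (c.net + sends i out))
  | recv (c : Config n k α) (src dst : Fin n) (m : Msg α)
      (net' : Multiset (Fin n × Fin n × Msg α)) (hd : dst ∉ F)
      (hq : Quiescent C t dst (c.node dst)) (hm : c.net = (src, dst, m) ::ₘ net') :
      Step C t F c (.recv src dst m)
        (c.setNode dst ((c.node dst).receive C t src m) net')
  | input (c : Config n k α) (i : Fin n) (w : Fin k → α) (hi : i ∉ F)
      (hq : Quiescent C t i (c.node i)) (ho : (c.node i).output = none)
      (hn : (c.node i).input = none) :
      Step C t F c (.input i w)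
        (c.setNode i ({ c.node i with input := some w } |>.passUA .one w)
          (c.net + sends i (some (symbolMsgs C i .one w))))
  | abba (c : Config n k α) (i : Fin n) (b : Bool) (hi : i ∉ F)
      (hq : Quiescent C t i (c.node i)) (ho : (c.node i).output = none)
      (hn : (c.node i).abbaOut = none) :
      Step C t F c (.abba i b)
        (c.setNode i
          { c.node i with abbaOut := some b, readySent := insert b (c.node i).readySent }
          (c.net + sends i (some fun _ => .ready b)))
  | byz (c : Config n k α) (src dst : Fin n) (m : Msg α) (hs : src ∈ F) :
      Step C t F c (.byz src dst m) { c with net := (src, dst, m) ::ₘ c.net }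
  | idle (c : Config n k α) : Step C t F c .idle c

/-- An infinite execution with dishonest set `F`: scheduling, initial messages and the behaviour of
the dishonest nodes are arbitrary, except that honest nodes do not stop in the middle of handling an
event and that messages between honest nodes are eventually received. Nothing is assumed about which
honest nodes get an initial message. -/
structure Execution (C : ErrorCorrectingCode n k α) (t : ℕ) (F : Finset (Fin n)) where
  cfg : ℕ → Config n k α
  event : ℕ → Event n k α
  start : cfg 0 = Config.init n k α
  step : ∀ T, Step C t F (cfg T) (event T) (cfg (T + 1))
  progress : ∀ i ∉ F, ∀ T, ∃ T' ≥ T, Quiescent C t i ((cfg T').node i)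
  reliable : ∀ src ∉ F, ∀ dst ∉ F, ∀ m T, (src, dst, m) ∈ (cfg T).net →
    ∃ T' ≥ T, event T' = .recv src dst m

/-- The binary agreement invoked in the execution is correct. Only its safety is required: honest
nodes never obtain different values (consistency), and a value obtained by an honest node has been
passed in by an honest node before (validity, in a form that is also meaningful while some honest
nodes have not passed in a value yet: were all values passed in so far different from the output,
then unanimous later inputs would violate validity). Neither termination nor totality of the binary
agreement is assumed. -/
structure ABBACorrect {C : ErrorCorrectingCode n k α} {t : ℕ} {F : Finset (Fin n)}
    (e : Execution C t F) : Prop where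
  consistency : ∀ i ∉ F, ∀ j ∉ F, ∀ T b b', ((e.cfg T).node i).abbaOut = some b →
    ((e.cfg T).node j).abbaOut = some b' → b = b'
  validity : ∀ i ∉ F, ∀ T b, ((e.cfg T).node i).abbaOut = some b →
    ∃ j ∉ F, ((e.cfg T).node j).abbaIn = some b

end Protocol

end ACOOL

/-! The READY phase makes the honest nodes agree on one bit. For the bit 1, unique agreement in the
second instance fixes one message $w$, and online decoding brings $w$ to everybody. Where the inputs
of the second instance come from is irrelevant, so the first instance is hardly tracked.

READY: every amplification rests on $t+1$ senders, one of them honest, so each honest READY goes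
back to an ABBA output at an honest node, and only one bit $v$ occurs. The $2t+1$ READY messages
behind a decision include $t+1$ honest ones. These reach everybody, so all honest nodes send READY
$v$ and all decide $v$ (`exists_vOut`), without any termination of ABBA. For $v=0$ only $\bot$ can
be output.

Uniqueness: for $v=1$, validity of ABBA gives an input 1, backed by $n-t$ positive SI2 messages,
hence by $t+1$ honest nodes with $s^{[2]}=1$. Distinct messages have encodings that agree at fewer
than $k\le t/3$ positions, and a link between two nodes forces agreement at both of their positions.
Counting links leaves at most two messages among honest nodes with $s^{[1]}=1$
(`eq_or_eq_of_linked`) and one among those with $s^{[2]}=1$ (`unique_of_linked`).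

Multicast: each symbol collected from an honest node is then a symbol of $w$ (`symFin_eq`), so a
successful decoding yields $w$. A node that outputs early has already sent either its symbols with a
positive SI2 or a CORRECTSYMBOL, so a node still waiting collects all honest symbols or decodes
before (`exists_output`). -/

namespace ACOOL

/-! ### Counting links with the distance of the code -/

section Combinatorics

variable {n k : ℕ} {α : Type*}

/-- Erase everything outside `S`: the remaining word has no error relative to either message and at
least `k` symbols, so the decoder must return both. -/
theorem ErrorCorrectingCode.eq_of_agree (C : ErrorCorrectingCode n k α) {w w' : Fin k → α}
    {S : Finset (Fin n)} (hS : k ≤ S.card) (h : ∀ j ∈ S, C.enc w j = C.enc w' j) : w = w' := by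
  classical
  have key : ∀ v : Fin k → α, (∀ j ∈ S, C.enc w j = C.enc v j) →
      C.dec (fun j => if j ∈ S then some (C.enc w j) else none) = v := by
    intro v hv
    apply C.dec_correct
    have h1 : {j | ∃ a, (if j ∈ S then some (C.enc w j) else none) = some a ∧ a ≠ C.enc v j}
        = (∅ : Set (Fin n)) := by
      ext j
      simp only [Set.mem_ofPred_eq, Set.mem_empty_iff_false, iff_false, not_exists, not_and, not_not]
      intro a ha
      split_ifs at ha with hj
      · rw [← Option.some.inj ha]; exact hv j hj
    have h2 : {j | (if j ∈ S then some (C.enc w j) else none) ≠ none} = (S : Set (Fin n)) := by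
      ext j
      by_cases hj : j ∈ S <;> simp [hj]
    rw [h1, h2, Set.ncard_empty, Set.ncard_coe_finset]
    omega
  rw [← key w fun _ _ => rfl, key w' h]

open Classical in
/-- Positions at which the encodings of two messages agree. -/
noncomputable def ErrorCorrectingCode.agree (C : ErrorCorrectingCode n k α) (w w' : Fin k → α) :
    Finset (Fin n) := Finset.univ.filter fun j => C.enc w j = C.enc w' j

theorem ErrorCorrectingCode.card_agree_lt (C : ErrorCorrectingCode n k α) {w w' : Fin k → α}
    (h : w ≠ w') : (C.agree w w').card < k := by
  by_contra hc
  exact h (C.eq_of_agree (not_lt.mp hc) fun j hj => by simpa [agree] using hj)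

/-- Node `i` with input `w` and node `j` are linked, where `x` gives the inputs of all nodes. -/
def Linked (C : ErrorCorrectingCode n k α) (x : Fin n → Option (Fin k → α)) (i : Fin n)
    (w : Fin k → α) (j : Fin n) : Prop :=
  ∃ w', x j = some w' ∧ C.enc w' i = C.enc w i ∧ C.enc w' j = C.enc w j

/-- The messages of all nodes in `V` coincide with one of two given distinct ones, if every node of
`V` is linked to all but `t` of the nodes in `H`. -/
theorem eq_or_eq_of_linked {t : ℕ} (hkt : 3 * k ≤ t) (C : ErrorCorrectingCode n k α)
    {x : Fin n → Option (Fin k → α)} {H V : Finset (Fin n)} (hH : 2 * t + 1 ≤ H.card)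
    (hV : ∀ i ∈ V, ∃ w, x i = some w ∧
      ∃ L ⊆ H, H.card ≤ L.card + t ∧ ∀ j ∈ L, Linked C x i w j)
    {i₁ i₂ i₃ : Fin n} {w₁ w₂ w₃ : Fin k → α} (h₁ : i₁ ∈ V) (h₂ : i₂ ∈ V) (h₃ : i₃ ∈ V)
    (x₁ : x i₁ = some w₁) (x₂ : x i₂ = some w₂) (x₃ : x i₃ = some w₃) (h₁₂ : w₁ ≠ w₂) :
    w₃ = w₁ ∨ w₃ = w₂ := by
  classical
  by_contra! hne
  have key : ∀ i ∈ V, ∀ w, x i = some w → ∃ L ⊆ H, H.card ≤ L.card + t ∧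
      ∀ j ∈ L, ∃ w', x j = some w' ∧ C.enc w' j = C.enc w j := by
    intro i hi w hw
    obtain ⟨w', hw', L, hL, hc, hl⟩ := hV i hi
    obtain rfl : w' = w := Option.some.inj (hw'.symm.trans hw)
    exact ⟨L, hL, hc, fun j hj => by obtain ⟨v, a, -, b⟩ := hl j hj; exact ⟨v, a, b⟩⟩
  obtain ⟨L₁, s₁, c₁, l₁⟩ := key _ h₁ _ x₁
  obtain ⟨L₂, s₂, c₂, l₂⟩ := key _ h₂ _ x₂
  obtain ⟨L₃, s₃, c₃, l₃⟩ := key _ h₃ _ x₃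
  -- A node in both link sets holds a single message, whose symbol at the node's own position equals
  -- both encodings there.
  have inter : ∀ {w w' : Fin k → α} {L L' : Finset (Fin n)},
      (∀ j ∈ L, ∃ v, x j = some v ∧ C.enc v j = C.enc w j) →
      (∀ j ∈ L', ∃ v, x j = some v ∧ C.enc v j = C.enc w' j) → w ≠ w' → (L ∩ L').card < k := by
    intro w w' L L' hl hl' hw
    refine lt_of_le_of_lt (Finset.card_le_card fun j hj => ?_) (C.card_agree_lt hw)
    obtain ⟨hj, hj'⟩ := Finset.mem_inter.mp hj
    obtain ⟨v, a, b⟩ := hl j hj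
    obtain ⟨v', a', b'⟩ := hl' j hj'
    obtain rfl : v = v' := Option.some.inj (a.symm.trans a')
    simp [ErrorCorrectingCode.agree, ← b, ← b']
  have d₁₂ := inter l₁ l₂ h₁₂
  have d₁₃ := inter l₁ l₃ (Ne.symm hne.1)
  have d₂₃ := inter l₂ l₃ (Ne.symm hne.2)
  have e₁ := Finset.card_union_add_card_inter L₁ L₂
  have e₂ := Finset.card_union_add_card_inter (L₁ ∪ L₂) L₃
  have e₃ : ((L₁ ∪ L₂) ∩ L₃).card ≤ (L₁ ∩ L₃).card + (L₂ ∩ L₃).card := by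
    rw [Finset.union_inter_distrib_right]; exact Finset.card_union_le _ _
  have e₄ := Finset.card_le_card (Finset.union_subset (Finset.union_subset s₁ s₂) s₃)
  -- Inclusion-exclusion gives $3(|H|-t)\le |H|+3(k-1)$, so $2|H|\le 3t+3k-3\le 4t-3$, against
  -- $|H|\ge 2t+1$.
  omega

/-- Unique agreement: all nodes with a positive second indicator have the same message, provided
that there are more than `t` of them. -/
theorem unique_of_linked {t : ℕ} (hkt : 3 * k ≤ t) (C : ErrorCorrectingCode n k α)
    {x : Fin n → Option (Fin k → α)} {H V₁ V₂ : Finset (Fin n)} (hH : 2 * t + 1 ≤ H.card)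
    (hV₁H : V₁ ⊆ H) (hV₂₁ : V₂ ⊆ V₁)
    (hV₁ : ∀ i ∈ V₁, ∃ w, x i = some w ∧
      ∃ L ⊆ H, H.card ≤ L.card + t ∧ ∀ j ∈ L, Linked C x i w j)
    (hV₂ : ∀ i ∈ V₂, ∃ w, x i = some w ∧
      ∃ L ⊆ V₁, H.card ≤ L.card + t ∧ ∀ j ∈ L, Linked C x i w j)
    (hcard : t + 1 ≤ V₂.card) {i i' : Fin n} (hi : i ∈ V₂) (hi' : i' ∈ V₂) : x i = x i' := by
  classical
  obtain ⟨w, hw, -⟩ := hV₂ i hi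
  obtain ⟨w', hw', -⟩ := hV₂ i' hi'
  rw [hw, hw']
  by_contra hne
  replace hne : w ≠ w' := fun h => hne (congrArg some h)
  have two : ∀ j ∈ V₁, x j = some w ∨ x j = some w' := by
    intro j hj
    obtain ⟨v, hv, -⟩ := hV₁ j hj
    rcases eq_or_eq_of_linked hkt C hH hV₁ (hV₂₁ hi) (hV₂₁ hi') hj hw hw' hv hne with rfl | rfl
    · exact .inl hv
    · exact .inr hv
  -- for either group: its members with a positive second indicator are agreement positions
  have main : ∀ (v v' : Fin k → α), v ≠ v' → (∀ j ∈ V₁, x j = some v ∨ x j = some v') →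
      (∃ l ∈ V₂, x l = some v) → (∃ l ∈ V₂, x l = some v') →
      ∀ l ∈ V₂, x l = some v → l ∈ C.agree v v' := by
    intro v v' hvv two ⟨l₀, hl₀, hx₀⟩ ⟨l₁, hl₁, hx₁⟩ l hl hxl
    by_contra hE
    -- A link of `l` forces equal symbols at position `l`, where `v` and `v'` differ. So `l` is
    -- linked only to holders of `v`, and to at least $|H|-t\ge t+1$ nodes.
    have big : t + 1 ≤ (H.filter fun j => x j = some v).card := by
      obtain ⟨u, hu, L, hL, hc, hlk⟩ := hV₂ l hl
      obtain rfl : u = v := Option.some.inj (hu.symm.trans hxl)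
      refine le_trans (by omega : t + 1 ≤ L.card) (Finset.card_le_card fun j hj => ?_)
      refine Finset.mem_filter.mpr ⟨hV₁H (hL hj), ?_⟩
      rcases two j (hL hj) with h | h
      · exact h
      · obtain ⟨u', hu', h1, -⟩ := hlk j hj
        obtain rfl : u' = v' := Option.some.inj (hu'.symm.trans h)
        exact absurd (by simp [ErrorCorrectingCode.agree, h1]) hE
    -- A holder `j` of `v'` at a position of disagreement is linked to no holder of `v`. That
    -- excludes $t+1$ nodes of `H`, while its links may miss only `t`.
    have sub : (V₁.filter fun j => x j = some v') ⊆ C.agree v v' := by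
      intro j hj
      obtain ⟨hj, hxj⟩ := Finset.mem_filter.mp hj
      by_contra hjE
      obtain ⟨u, hu, L, hL, hc, hlk⟩ := hV₁ j hj
      obtain rfl : u = v' := Option.some.inj (hu.symm.trans hxj)
      have hdis : Disjoint L (H.filter fun j => x j = some v) := by
        rw [Finset.disjoint_left]
        intro m hm hm'
        obtain ⟨u', hu', h1, -⟩ := hlk m hm
        obtain rfl : u' = v := Option.some.inj (hu'.symm.trans (Finset.mem_filter.mp hm').2)
        exact hjE (by simp [ErrorCorrectingCode.agree, h1])
      have h1 := Finset.card_union_of_disjoint hdis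
      have h2 := Finset.card_le_card (Finset.union_subset hL (Finset.filter_subset
        (fun j => x j = some v) H))
      omega
    obtain ⟨u, hu, L, hL, hc, hlk⟩ := hV₂ l₁ hl₁
    obtain rfl : u = v' := Option.some.inj (hu.symm.trans hx₁)
    -- A holder of `v` linked to `l₁` agrees with `v'` at its own position; holders of `v'` are
    -- covered by `sub`. Thus more than `t` links lie in a set of fewer than `k` positions.
    have hsub : L ⊆ C.agree v u := by
      intro j hj
      rcases two j (hL hj) with h | h
      · obtain ⟨u', hu', -, h1⟩ := hlk j hj
        obtain rfl : u' = v := Option.some.inj (hu'.symm.trans h)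
        simp [ErrorCorrectingCode.agree, h1]
      · exact sub (Finset.mem_filter.mpr ⟨hL hj, h⟩)
    have h1 := Finset.card_le_card hsub
    have h2 := C.card_agree_lt hvv
    omega
  have hsub : V₂ ⊆ C.agree w w' := by
    intro l hl
    rcases two l (hV₂₁ hl) with h | h
    · exact main w w' hne two ⟨i, hi, hw⟩ ⟨i', hi', hw'⟩ l hl h
    · have := main w' w hne.symm (fun j hj => (two j hj).symm) ⟨i', hi', hw'⟩ ⟨i, hi, hw⟩ l hl h
      simpa [ErrorCorrectingCode.agree, eq_comm] using this
  have h1 := Finset.card_le_card hsub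
  have h2 := C.card_agree_lt hne
  omega

end Combinatorics

/-! ### Monotonicity of local states and justification of sent messages -/

section LocalSteps

variable {n k : ℕ} {α : Type*} {C : ErrorCorrectingCode n k α} {t : ℕ} {i : Fin n}
  {N : Multiset (Fin n × Fin n × Msg α)} {s s' : NodeState n k α}
  {out : Option (Fin n → Msg α)}

/-- What can happen to the honest node `i` in one step of an execution, when `N` is the multiset of
messages in transit. -/
inductive LocalStep (C : ErrorCorrectingCode n k α) (t : ℕ) (i : Fin n)
    (N : Multiset (Fin n × Fin n × Msg α)) :
    NodeState n k α → Option (Fin n → Msg α) → NodeState n k α → Prop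
  | clause (s : NodeState n k α) (out : Option (Fin n → Msg α)) (s' : NodeState n k α)
      (h : Clause C t i s out s') : LocalStep C t i N s out s'
  | receive (s : NodeState n k α) (j : Fin n) (m : Msg α) (hq : Quiescent C t i s)
      (hm : (j, i, m) ∈ N) : LocalStep C t i N s none (s.receive C t j m)
  | input (s : NodeState n k α) (w : Fin k → α) : LocalStep C t i N s
      (some (symbolMsgs C i .one w)) ({ s with input := some w } |>.passUA .one w)
  | abba (s : NodeState n k α) (b : Bool) (ho : s.output = none) (hn : s.abbaOut = none) :
      LocalStep C t i N s (some fun _ => .ready b)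
        { s with abbaOut := some b, readySent := insert b s.readySent }
  | stutter (s : NodeState n k α) : LocalStep C t i N s none s

theorem addNew_eq (C : ErrorCorrectingCode n k α) (t : ℕ) (s : NodeState n k α) (j : Fin n)
    (y : α) : ∃ f c o, s.addNew C t j y = { s with symNew := f, cand := c, oecNew := o } := by
  unfold NodeState.addNew
  dsimp only
  split_ifs
  · exact ⟨_, _, _, rfl⟩
  · exact ⟨_, s.cand, s.oecNew, rfl⟩

/-- A failed attempt needs no information on `d`: the decoded message matters only once the success
flag is set. -/
theorem addFin_eq (C : ErrorCorrectingCode n k α) (t : ℕ) (s : NodeState n k α) (j : Fin n)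
    (y : α) : ∃ d o, s.addFin C t j y =
      { s with symFin := Function.update s.symFin j (some y), decoded := d, oecFin := o } ∧
      (OECSucceeds C t (Function.update s.symFin j (some y)) ∧ o = true ∧
        d = some (C.dec (Function.update s.symFin j (some y))) ∨
      ¬ OECSucceeds C t (Function.update s.symFin j (some y)) ∧ o = s.oecFin) := by
  unfold NodeState.addFin
  dsimp only
  split_ifs with h
  · exact ⟨_, _, rfl, .inl ⟨h, rfl, rfl⟩⟩
  · exact ⟨s.decoded, s.oecFin, rfl, .inr ⟨h, rfl⟩⟩

/-- The monotone part of the local state. -/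
structure Ext (s s' : NodeState n k α) : Prop where
  inp : ∀ w, (s.ua .two).inp = some w → (s'.ua .two).inp = some w
  s1 : ∀ b, (s.ua .two).s1 = some b → (s'.ua .two).s1 = some b
  s2 : ∀ b, (s.ua .two).s2 = some b → (s'.ua .two).s2 = some b
  sym : ∀ j x, (s.ua .two).sym j = some x → (s'.ua .two).sym j = some x
  si1 : ∀ j x, (s.ua .two).si1 j = some x → (s'.ua .two).si1 j = some x
  si2 : ∀ j x, (s.ua .two).si2 j = some x → (s'.ua .two).si2 j = some x
  readySent : s.readySent ⊆ s'.readySent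
  ready : ∀ v, s.ready v ⊆ s'.ready v
  vOut : ∀ b, s.vOut = some b → s'.vOut = some b
  correctSent : s.correctSent = true → s'.correctSent = true
  symFin : ∀ j y, s.symFin j = some y → s'.symFin j = some y
  oecFin : s.oecFin = true → s'.oecFin = true
  abbaOut : ∀ b, s.abbaOut = some b → s'.abbaOut = some b
  output : ∀ x, s.output = some x → s'.output = some x

theorem Ext.refl (s : NodeState n k α) : Ext s s := by
  constructor <;> simp

theorem Ext.trans {s₁ s₂ s₃ : NodeState n k α} (h : Ext s₁ s₂) (h' : Ext s₂ s₃) : Ext s₁ s₃ where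
  inp w hw := h'.inp w (h.inp w hw)
  s1 w hw := h'.s1 w (h.s1 w hw)
  s2 w hw := h'.s2 w (h.s2 w hw)
  sym j w hw := h'.sym j w (h.sym j w hw)
  si1 j w hw := h'.si1 j w (h.si1 j w hw)
  si2 j w hw := h'.si2 j w (h.si2 j w hw)
  readySent := h.readySent.trans h'.readySent
  ready v := (h.ready v).trans (h'.ready v)
  vOut w hw := h'.vOut w (h.vOut w hw)
  correctSent hw := h'.correctSent (h.correctSent hw)
  symFin j w hw := h'.symFin j w (h.symFin j w hw)
  oecFin hw := h'.oecFin (h.oecFin hw)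
  abbaOut w hw := h'.abbaOut w (h.abbaOut w hw)
  output w hw := h'.output w (h.output w hw)

theorem ext_addNew (j : Fin n) (y : α) : Ext s (s.addNew C t j y) := by
  obtain ⟨f, c, o, h⟩ := addNew_eq C t s j y
  rw [h]
  constructor <;> simp

theorem ext_addFin (j : Fin n) (y : α) (hj : s.symFin j = none) : Ext s (s.addFin C t j y) := by
  obtain ⟨d, o, h, h'⟩ := addFin_eq C t s j y
  rw [h]
  constructor <;> (try simp; done)
  · intro l z hl
    have : l ≠ j := by rintro rfl; simp [hj] at hl
    simp [Function.update_of_ne this, hl]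
  · rcases h' with ⟨-, h, -⟩ | ⟨-, h⟩ <;> simp [h]

theorem Clause.ext (h : Clause C t i s out s') : Ext s s' := by
  cases h
  case collectNew => exact ext_addNew _ _
  case collectFin hn _ => exact ext_addFin _ _ hn
  case s1One p _ _ _ => cases p <;> constructor <;> simp_all [NodeState.setUA]
  case s1Zero p _ _ _ => cases p <;> constructor <;> simp_all [NodeState.setUA]
  case s2One p _ _ _ _ => cases p <;> constructor <;> simp_all [NodeState.setUA]
  case s2Zero p _ _ _ => cases p <;> constructor <;> simp_all [NodeState.setUA]
  case voteOne p _ _ _ => cases p <;> constructor <;> simp_all [NodeState.setUA]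
  case voteZero p _ _ _ => cases p <;> constructor <;> simp_all [NodeState.setUA]
  all_goals constructor <;> simp_all [NodeState.passUA, NodeState.setUA]

theorem update_some_of_eq_none {β : Type*} {f : Fin n → Option β} {j : Fin n} (hf : f j = none)
    (b : β) (l : Fin n) (x : β) (hl : f l = some x) : Function.update f j (some b) l = some x := by
  have : l ≠ j := by rintro rfl; simp [hf] at hl
  simp [Function.update_of_ne this, hl]

/-- The possible effects of the reception of a message from node `j`. -/
inductive Reception (C : ErrorCorrectingCode n k α) (t : ℕ) (s : NodeState n k α) (j : Fin n) :
    Msg α → NodeState n k α → Prop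
  | ignored (m : Msg α) : Reception C t s j m s
  | symbol (p : Inst) (a b : α) (ho : s.output = none) (h : (s.ua p).sym j = none) :
      Reception C t s j (.symbol p a b)
        (s.setUA p { s.ua p with sym := Function.update (s.ua p).sym j (some (a, b)) })
  | si1 (p : Inst) (b : Bool) (ho : s.output = none) (h : (s.ua p).si1 j = none) :
      Reception C t s j (.si1 p b)
        (s.setUA p { s.ua p with si1 := Function.update (s.ua p).si1 j (some b) })
  | si2 (p : Inst) (b : Bool) (ho : s.output = none) (h : (s.ua p).si2 j = none) :
      Reception C t s j (.si2 p b)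
        (s.setUA p { s.ua p with si2 := Function.update (s.ua p).si2 j (some b) })
  | newSymbol (y : α) (ho : s.output = none) :
      Reception C t s j (.newSymbol y) (s.addNew C t j y)
  | ready (v : Bool) (ho : s.output = none) : Reception C t s j (.ready v)
      { s with ready := Function.update s.ready v (insert j (s.ready v)) }
  | correctSymbol (y : α) (ho : s.output = none) (h : s.symFin j = none) (hf : s.oecFin = false) :
      Reception C t s j (.correctSymbol y) (s.addFin C t j y)

theorem reception_receive (C : ErrorCorrectingCode n k α) (t : ℕ) (s : NodeState n k α)
    (j : Fin n) (m : Msg α) : Reception C t s j m (s.receive C t j m) := by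
  by_cases ho : s.output = none
  · rcases m with ⟨p, a, b⟩ | ⟨p, b⟩ | ⟨p, b⟩ | y | v | y <;>
      simp only [NodeState.receive, ho, ne_eq, not_true_eq_false, if_false]
    · split_ifs with h
      exacts [.symbol p a b ho h, .ignored _]
    · split_ifs with h
      exacts [.si1 p b ho h, .ignored _]
    · split_ifs with h
      exacts [.si2 p b ho h, .ignored _]
    · split_ifs with h
      exacts [.newSymbol y ho, .ignored _]
    · convert Reception.ready v ho using 2
      exact ho.symm
    · split_ifs with h
      exacts [.correctSymbol y ho h.1 h.2, .ignored _]
  · simp only [NodeState.receive, ne_eq, ho, not_false_eq_true, if_true]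
    exact .ignored _

theorem Reception.ext {j : Fin n} {m : Msg α} (h : Reception C t s j m s') : Ext s s' := by
  cases h
  case ignored => exact Ext.refl s
  case newSymbol => exact ext_addNew _ _
  case correctSymbol h _ => exact ext_addFin _ _ h
  case symbol p a b ho h =>
    cases p <;> constructor <;>
      first | exact update_some_of_eq_none h _ | simp [NodeState.setUA]
  case si1 p b ho h =>
    cases p <;> constructor <;>
      first | exact update_some_of_eq_none h _ | simp [NodeState.setUA]
  case si2 p b ho h =>
    cases p <;> constructor <;>
      first | exact update_some_of_eq_none h _ | simp [NodeState.setUA]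
  case ready v ho =>
    constructor <;> (try simp; done)
    intro u
    by_cases h : u = v
    · subst h; simp
    · simp [Function.update_of_ne h]

theorem LocalStep.ext (h : LocalStep C t i N s out s') : Ext s s' := by
  cases h
  case clause h => exact h.ext
  case receive j m _ _ => exact (reception_receive C t s j m).ext
  case input w => constructor <;> simp [NodeState.passUA, NodeState.setUA]
  case abba b ho hn => constructor <;> simp_all
  case stutter => exact Ext.refl s

theorem Ext.link1 (h : Ext s s') : (s.ua .two).link1 C i ⊆ (s'.ua .two).link1 C i := by
  rintro j ⟨w, a, b, hw, hs, he⟩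
  exact ⟨w, a, b, h.inp _ hw, h.sym _ _ hs, he⟩

theorem Ext.set1 (h : Ext s s') (b : Bool) : (s.ua .two).set1 b ⊆ (s'.ua .two).set1 b :=
  fun j hj => h.si1 j b hj

theorem Ext.set2 (h : Ext s s') (b : Bool) : (s.ua .two).set2 b ⊆ (s'.ua .two).set2 b :=
  fun j hj => h.si2 j b hj

theorem Ext.votes (h : Ext s s') (y : α) : (s.ua .two).votes y ⊆ (s'.ua .two).votes y := by
  rintro j ⟨b, hb⟩
  exact ⟨b, h.sym _ _ hb⟩

/-- What is known about an honest sender in state `s` of the message `m` to node `dst`. -/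
def Justified (C : ErrorCorrectingCode n k α) (t : ℕ) (i dst : Fin n) (s : NodeState n k α) :
    Msg α → Prop
  | .symbol .two a b => ∃ w, (s.ua .two).inp = some w ∧ a = C.enc w dst ∧ b = C.enc w i
  | .si1 .two b => (s.ua .two).s1 = some b
  | .si2 .two b => (s.ua .two).s2 = some b
  | .ready v => v ∈ s.readySent
  | .correctSymbol y => t + 1 ≤ ((s.ua .two).votes y ∩ (s.ua .two).set2 true).ncard
  | _ => True

/-- Justifications use only monotone components, so they survive arbitrary message delays. -/
theorem Justified.mono (h : Ext s s') {dst : Fin n} {m : Msg α} (hm : Justified C t i dst s m) :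
    Justified C t i dst s' m := by
  rcases m with ⟨_ | _, a, b⟩ | ⟨_ | _, b⟩ | ⟨_ | _, b⟩ | y | v | y
  · trivial
  · obtain ⟨w, hw, h'⟩ := hm
    exact ⟨w, h.inp _ hw, h'⟩
  · trivial
  · exact h.s1 _ hm
  · trivial
  · exact h.s2 _ hm
  · trivial
  · exact h.readySent hm
  · exact hm.trans (Set.ncard_le_ncard (Set.inter_subset_inter (h.votes y) (h.set2 true))
      (Set.toFinite _))

theorem LocalStep.justified {f : Fin n → Msg α} (h : LocalStep C t i N s (some f) s')
    (dst : Fin n) : Justified C t i dst s' (f dst) := by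
  cases h
  case clause h =>
    cases h
    case s1One p _ _ _ => cases p <;> simp [Justified, NodeState.setUA]
    case s1Zero p _ _ _ => cases p <;> simp [Justified, NodeState.setUA]
    case s2One p _ _ _ _ => cases p <;> simp [Justified, NodeState.setUA]
    case s2Zero p _ _ _ => cases p <;> simp [Justified, NodeState.setUA]
    all_goals simp_all [Justified, symbolMsgs, NodeState.passUA, NodeState.setUA]
  case input => trivial
  case abba => simp [Justified]

end LocalSteps

/-! ### Causes of local state changes -/

section LocalChange

variable {n k : ℕ} {α : Type*} {C : ErrorCorrectingCode n k α} {t : ℕ} {i : Fin n}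
  {N : Multiset (Fin n × Fin n × Msg α)} {s s' : NodeState n k α}
  {out : Option (Fin n → Msg α)}

/-- The reasons for which a component of the local state can change. -/
structure Change (C : ErrorCorrectingCode n k α) (t : ℕ) (i : Fin n)
    (N : Multiset (Fin n × Fin n × Msg α)) (s : NodeState n k α) (out : Option (Fin n → Msg α))
    (s' : NodeState n k α) : Prop where
  inp : ∀ w, (s'.ua .two).inp = some w → (s.ua .two).inp = some w ∨
    out = some (symbolMsgs C i .two w)
  s1 : (s'.ua .two).s1 = some true → (s.ua .two).s1 = some true ∨
    n - t ≤ ((s.ua .two).link1 C i).ncard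
  s2 : ∀ b, (s'.ua .two).s2 = some b → (s.ua .two).s2 = some b ∨
    out = some (fun _ => .si2 .two b) ∧ (b = true → (s.ua .two).s1 = some true ∧
      n - t ≤ ((s.ua .two).set1 true ∩ (s.ua .two).link1 C i).ncard)
  v : (s'.ua .two).v = some true → (s.ua .two).v = some true ∨
    n - t ≤ ((s.ua .two).set2 true).ncard
  abbaIn : s'.abbaIn = some true → s.abbaIn = some true ∨ (s.ua .two).v = some true
  readySent : ∀ v, v ∈ s'.readySent → v ∈ s.readySent ∨ out = some (fun _ => .ready v) ∧
    (s'.abbaOut = some v ∨ t + 1 ≤ (s.ready v).card)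
  readyCard : ∀ v, t + 1 < (s'.ready v).card → t + 1 < (s.ready v).card ∨ s'.readySent ≠ ∅
  vOut : ∀ v, s'.vOut = some v → s.vOut = some v ∨
    2 * t + 1 ≤ (s.ready v).card ∧ (v = false → s'.output ≠ none)
  waiting : s'.waiting = true → s.waiting = true ∨ s.vOut = some true
  correctSent : s'.correctSent = true → s.correctSent = true ∨
    s.waiting = true ∧ ∃ y, out = some fun _ => .correctSymbol y
  output : ∀ x, s'.output = some x → s.output = some x ∨
    (x = none ∧ s'.vOut = some false) ∨
    (s.vOut = some true ∧ (s.ua .two).s2 = some true ∧ x = (s.ua .two).inp) ∨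
    (s.correctSent = true ∧ s.oecFin = true ∧ x = s.decoded)
  fin : (s'.symFin = s.symFin ∧ s'.oecFin = s.oecFin ∧ s'.decoded = s.decoded) ∨
    s.oecFin = false ∧
      (OECSucceeds C t s'.symFin ∧ s'.oecFin = true ∧ s'.decoded = some (C.dec s'.symFin) ∨
      ¬ OECSucceeds C t s'.symFin ∧ s'.oecFin = false)
  symFin : ∀ j y, s'.symFin j = some y → s.symFin j = some y ∨
    (∃ a, (s.ua .two).sym j = some (a, y) ∧ (s.ua .two).si2 j = some true) ∨
    (j, i, .correctSymbol y) ∈ N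
  sym : ∀ j a b, (s'.ua .two).sym j = some (a, b) → (s.ua .two).sym j = some (a, b) ∨
    (j, i, .symbol .two a b) ∈ N
  si1 : ∀ j b, (s'.ua .two).si1 j = some b → (s.ua .two).si1 j = some b ∨ (j, i, .si1 .two b) ∈ N
  si2 : ∀ j b, (s'.ua .two).si2 j = some b → (s.ua .two).si2 j = some b ∨ (j, i, .si2 .two b) ∈ N
  ready : ∀ j v, j ∈ s'.ready v → j ∈ s.ready v ∨ (j, i, .ready v) ∈ N

theorem Change.refl : Change C t i N s out s := by
  constructor <;> first
    | exact .inl | exact fun _ => .inl | exact fun _ _ => .inl | exact fun _ _ _ => .inl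
    | exact .inl ⟨rfl, rfl, rfl⟩

theorem change_addNew (j : Fin n) (y : α) : Change C t i N s out (s.addNew C t j y) := by
  obtain ⟨f, c, o, h⟩ := addNew_eq C t s j y
  rw [h]
  constructor <;> first
    | exact .inl | exact fun _ => .inl | exact fun _ _ => .inl | exact fun _ _ _ => .inl
    | exact .inl ⟨rfl, rfl, rfl⟩

theorem eq_or_of_update_some {β : Type*} {f : Fin n → Option β} {j l : Fin n} {b x : β}
    (h : Function.update f j (some b) l = some x) : f l = some x ∨ j = l ∧ b = x := by
  by_cases hl : l = j
  · subst hl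
    exact .inr ⟨rfl, by simpa using h⟩
  · exact .inl (by simpa [Function.update_of_ne hl] using h)

theorem change_addFin (j : Fin n) (y : α) (hf : s.oecFin = false)
    (hj : (∃ a, (s.ua .two).sym j = some (a, y) ∧ (s.ua .two).si2 j = some true) ∨
      (j, i, .correctSymbol y) ∈ N) : Change C t i N s out (s.addFin C t j y) := by
  obtain ⟨d, o, h, h'⟩ := addFin_eq C t s j y
  rw [h]
  constructor
  case fin =>
    right
    rcases h' with ⟨h1, h2, h3⟩ | ⟨h1, h2⟩
    · exact ⟨hf, .inl ⟨h1, h2, h3⟩⟩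
    · exact ⟨hf, .inr ⟨h1, h2.trans hf⟩⟩
  case symFin =>
    intro l z hl
    rcases eq_or_of_update_some hl with h | ⟨rfl, rfl⟩
    · exact .inl h
    · exact .inr hj
  all_goals first
    | exact .inl | exact fun _ => .inl | exact fun _ _ => .inl | exact fun _ _ _ => .inl

theorem Clause.change (h : Clause C t i s out s') : Change C t i N s out s' := by
  cases h
  case collectNew => exact change_addNew _ _
  case collectFin j a y _ hy hj _ hf => exact change_addFin j y hf (.inl ⟨a, hy, hj⟩)
  case s1One p h hL hs =>
    cases p <;> constructor
    case two.s1 => exact fun _ => .inr hL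
    all_goals first
      | exact .inl | exact fun _ => .inl | exact fun _ _ => .inl | exact fun _ _ _ => .inl
      | exact .inl ⟨rfl, rfl, rfl⟩
  case s1Zero p h hL hs =>
    cases p <;> constructor
    case two.s1 => intro h; simp [NodeState.setUA] at h
    all_goals first
      | exact .inl | exact fun _ => .inl | exact fun _ _ => .inl | exact fun _ _ _ => .inl
      | exact .inl ⟨rfl, rfl, rfl⟩
  case s2Zero p h hc hs =>
    cases p <;> constructor
    case two.s2 =>
      intro b hb
      obtain rfl : false = b := by simpa [NodeState.setUA] using hb
      exact .inr ⟨rfl, by simp⟩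
    all_goals first
      | exact .inl | exact fun _ => .inl | exact fun _ _ => .inl | exact fun _ _ _ => .inl
      | exact .inl ⟨rfl, rfl, rfl⟩
  case s2One p h h1 hc hs =>
    cases p <;> constructor
    case two.s2 =>
      intro b hb
      obtain rfl : true = b := by simpa [NodeState.setUA] using hb
      exact .inr ⟨rfl, fun _ => ⟨h1, hc⟩⟩
    all_goals first
      | exact .inl | exact fun _ => .inl | exact fun _ _ => .inl | exact fun _ _ _ => .inl
      | exact .inl ⟨rfl, rfl, rfl⟩
  case voteOne p h hc hv =>
    cases p <;> constructor
    case two.v => exact fun _ => .inr hc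
    all_goals first
      | exact .inl | exact fun _ => .inl | exact fun _ _ => .inl | exact fun _ _ _ => .inl
      | exact .inl ⟨rfl, rfl, rfl⟩
  case voteZero p h hc hv =>
    cases p <;> constructor
    case two.v => intro h; simp [NodeState.setUA] at h
    all_goals first
      | exact .inl | exact fun _ => .inl | exact fun _ _ => .inl | exact fun _ _ _ => .inl
      | exact .inl ⟨rfl, rfl, rfl⟩
  all_goals constructor
  case passOwn.inp w _ _ _ _ =>
    intro w' hw'
    obtain rfl : w = w' := by simpa [NodeState.passUA, NodeState.setUA] using hw'
    exact .inr rfl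
  case passCand.inp w _ _ _ =>
    intro w' hw'
    obtain rfl : w = w' := by simpa [NodeState.passUA, NodeState.setUA] using hw'
    exact .inr rfl
  case abbaVote.abbaIn b h hv ha => exact fun h => .inr (hv.trans h)
  case abbaZero.abbaIn => intro h; simp at h
  case readyAmplify.readySent v h hr hs =>
    intro u hu
    obtain rfl : u = v := by simpa using hu
    exact .inr ⟨rfl, .inr hr⟩
  case setZero.vOut h hr hv =>
    intro v hv
    obtain rfl : false = v := by simpa using hv
    exact .inr ⟨hr, by simp⟩
  case setZero.output h hr hv =>
    intro x hx
    obtain rfl : none = x := by simpa using hx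
    exact .inr (.inl ⟨rfl, rfl⟩)
  case setOne.vOut h hr hv =>
    intro v hv
    obtain rfl : true = v := by simpa using hv
    exact .inr ⟨hr, by simp⟩
  case outputOwn.output h hv hw hd h2 =>
    intro x hx
    exact .inr (.inr (.inl ⟨hv, h2, (Option.some.inj hx).symm⟩))
  case enterWait.waiting h hv hw hd => exact fun _ => .inr hv
  case correct.correctSent y h hw hc hy => exact fun _ => .inr ⟨hw, y, rfl⟩
  case outputDecoded.output h hc hf =>
    intro x hx
    exact .inr (.inr (.inr ⟨hc, hf, (Option.some.inj hx).symm⟩))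
  all_goals first
    | exact .inl | exact fun _ => .inl | exact fun _ _ => .inl | exact fun _ _ _ => .inl
    | exact .inl ⟨rfl, rfl, rfl⟩

theorem Reception.change {j : Fin n} {m : Msg α} (hq : Quiescent C t i s) (hm : (j, i, m) ∈ N)
    (h : Reception C t s j m s') : Change C t i N s out s' := by
  cases h
  case ignored => exact Change.refl
  case newSymbol => exact change_addNew _ _
  case correctSymbol h hf => exact change_addFin _ _ hf (.inr hm)
  case symbol p a b ho h =>
    cases p <;> constructor
    case two.sym =>
      intro l a' b' hl
      rcases eq_or_of_update_some hl with h | ⟨rfl, h⟩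
      · exact .inl h
      · cases h; exact .inr hm
    all_goals first
      | exact .inl | exact fun _ => .inl | exact fun _ _ => .inl | exact fun _ _ _ => .inl
      | exact .inl ⟨rfl, rfl, rfl⟩
  case si1 p b ho h =>
    cases p <;> constructor
    case two.si1 =>
      intro l b' hl
      rcases eq_or_of_update_some hl with h | ⟨rfl, rfl⟩
      · exact .inl h
      · exact .inr hm
    all_goals first
      | exact .inl | exact fun _ => .inl | exact fun _ _ => .inl | exact fun _ _ _ => .inl
      | exact .inl ⟨rfl, rfl, rfl⟩
  case si2 p b ho h =>
    cases p <;> constructor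
    case two.si2 =>
      intro l b' hl
      rcases eq_or_of_update_some hl with h | ⟨rfl, rfl⟩
      · exact .inl h
      · exact .inr hm
    all_goals first
      | exact .inl | exact fun _ => .inl | exact fun _ _ => .inl | exact fun _ _ _ => .inl
      | exact .inl ⟨rfl, rfl, rfl⟩
  case ready v ho =>
    constructor
    case ready =>
      intro l u hl
      by_cases hu : u = v
      · subst hu
        rcases Finset.mem_insert.mp (by simpa using hl) with rfl | h
        · exact .inr hm
        · exact .inl h
      · exact .inl (by simpa [Function.update_of_ne hu] using hl)
    case readyCard =>
      intro u hu
      by_cases he : s.readySent = ∅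
      · left
        by_contra hc
        by_cases huv : u = v
        · subst huv
          -- A message is received only in a quiescent state. One reception adds at most one sender,
          -- so `t + 1` senders were present before and amplification would still have been enabled.
          have h1 : (Function.update s.ready u (insert j (s.ready u)) u).card ≤
              (s.ready u).card + 1 := by simpa using Finset.card_insert_le j (s.ready u)
          have h2 : t + 1 ≤ (s.ready u).card := by
            dsimp only at hu
            omega
          exact hq _ _ (.readyAmplify s u ho h2 he)
        · exact hc (by simpa [Function.update_of_ne huv] using hu)
      · exact .inr he
    all_goals first
      | exact .inl | exact fun _ => .inl | exact fun _ _ => .inl | exact fun _ _ _ => .inl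
      | exact .inl ⟨rfl, rfl, rfl⟩

theorem LocalStep.change (h : LocalStep C t i N s out s') : Change C t i N s out s' := by
  cases h
  case clause h => exact h.change
  case receive j m hq hm => exact (reception_receive C t s j m).change hq hm
  case stutter => exact Change.refl
  all_goals constructor
  case abba.readySent b ho hn =>
    intro v hv
    rcases Finset.mem_insert.mp hv with rfl | h
    · exact .inr ⟨rfl, .inl rfl⟩
    · exact .inl h
  case abba.readyCard => exact fun v h => .inl h
  all_goals first
    | exact .inl | exact fun _ => .inl | exact fun _ _ => .inl | exact fun _ _ _ => .inl
    | exact .inl ⟨rfl, rfl, rfl⟩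

end LocalChange

/-! ### Invariants of one node -/

section LocalInvariants

variable {n k : ℕ} {α : Type*} {C : ErrorCorrectingCode n k α} {t : ℕ} {i : Fin n}
  {N : Multiset (Fin n × Fin n × Msg α)} {s s' : NodeState n k α}
  {out : Option (Fin n → Msg α)}

/-- Invariants of the local state of an honest node. -/
structure NodeInv (C : ErrorCorrectingCode n k α) (t : ℕ) (i : Fin n) (s : NodeState n k α) :
    Prop where
  s1 : (s.ua .two).s1 = some true → n - t ≤ ((s.ua .two).link1 C i).ncard
  s2 : (s.ua .two).s2 = some true → (s.ua .two).s1 = some true ∧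
    n - t ≤ ((s.ua .two).set1 true ∩ (s.ua .two).link1 C i).ncard
  v : (s.ua .two).v = some true → n - t ≤ ((s.ua .two).set2 true).ncard
  abbaIn : s.abbaIn = some true → n - t ≤ ((s.ua .two).set2 true).ncard
  readyCard : ∀ v, t + 1 < (s.ready v).card → s.readySent ≠ ∅
  vOut : ∀ v, s.vOut = some v → 2 * t + 1 ≤ (s.ready v).card
  halt : s.vOut = some false → s.output ≠ none
  waiting : s.waiting = true → s.vOut = some true
  correctSent : s.correctSent = true → s.vOut = some true
  oec_false : s.oecFin = false → ¬ OECSucceeds C t s.symFin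
  oec_true : s.oecFin = true → OECSucceeds C t s.symFin ∧ s.decoded = some (C.dec s.symFin)
  output : ∀ x, s.output = some x → (x = none ∧ s.vOut = some false) ∨ s.vOut = some true ∧
    ((s.ua .two).s2 = some true ∧ (∃ w, (s.ua .two).inp = some w ∧ x = some w) ∨
      s.correctSent = true ∧ s.oecFin = true ∧ x = some (C.dec s.symFin))

theorem nodeInv_init (C : ErrorCorrectingCode n k α) (hk : 1 ≤ k) (i : Fin n) :
    NodeInv C t i (NodeState.init n k α) := by
  constructor <;> simp [NodeState.init, UAState.init, OECSucceeds]
  -- An empty collection is no success because `k + t` is positive.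
  omega

theorem NodeInv.step (hn : t < n) (hI : NodeInv C t i s) (h : LocalStep C t i N s out s') :
    NodeInv C t i s' := by
  have hE := h.ext
  have hC := h.change
  have hlink {m : ℕ} (h : m ≤ ((s.ua .two).link1 C i).ncard) :
      m ≤ ((s'.ua .two).link1 C i).ncard :=
    h.trans (Set.ncard_le_ncard hE.link1 (Set.toFinite _))
  have hset {m : ℕ} (h : m ≤ ((s.ua .two).set2 true).ncard) :
      m ≤ ((s'.ua .two).set2 true).ncard :=
    h.trans (Set.ncard_le_ncard (hE.set2 true) (Set.toFinite _))
  have hready {m : ℕ} {v : Bool} (h : m ≤ (s.ready v).card) : m ≤ (s'.ready v).card :=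
    h.trans (Finset.card_le_card (hE.ready v))
  constructor
  case s1 => exact fun h => hlink ((hC.s1 h).elim hI.s1 id)
  case s2 =>
    intro h
    obtain ⟨h1, h2⟩ := (hC.s2 _ h).elim hI.s2 fun h => h.2 rfl
    exact ⟨hE.s1 _ h1, h2.trans (Set.ncard_le_ncard
      (Set.inter_subset_inter (hE.set1 true) hE.link1) (Set.toFinite _))⟩
  case v => exact fun h => hset ((hC.v h).elim hI.v id)
  case abbaIn => exact fun h => hset ((hC.abbaIn h).elim hI.abbaIn hI.v)
  case readyCard =>
    intro v h
    rcases hC.readyCard v h with h | h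
    · obtain ⟨u, hu⟩ := Finset.nonempty_iff_ne_empty.mpr (hI.readyCard v h)
      exact Finset.ne_empty_of_mem (hE.readySent hu)
    · exact h
  case vOut => exact fun v h => hready ((hC.vOut v h).elim (hI.vOut v) And.left)
  case halt =>
    intro h
    rcases hC.vOut _ h with h | h
    · obtain ⟨x, hx⟩ := Option.ne_none_iff_exists'.mp (hI.halt h)
      simp [hE.output x hx]
    · exact h.2 rfl
  case waiting => exact fun h => hE.vOut _ ((hC.waiting h).elim hI.waiting id)
  case correctSent =>
    exact fun h => hE.vOut _ ((hC.correctSent h).elim hI.correctSent fun h => hI.waiting h.1)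
  case oec_false =>
    intro h
    rcases hC.fin with ⟨h1, h2, -⟩ | ⟨-, ⟨-, h2, -⟩ | ⟨h1, -⟩⟩
    · rw [h1]; exact hI.oec_false (h2.symm.trans h)
    · simp [h] at h2
    · exact h1
  case oec_true =>
    intro h
    rcases hC.fin with ⟨h1, h2, h3⟩ | ⟨-, ⟨h1, -, h3⟩ | ⟨-, h2⟩⟩
    · rw [h1, h3]; exact hI.oec_true (h2.symm.trans h)
    · exact ⟨h1, h3⟩
    · simp [h] at h2
  case output =>
    -- The collection freezes on success, so the output remains the decoding of the current
    -- `symFin`.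
    have hfin : s.oecFin = true → s'.symFin = s.symFin := by
      intro h
      rcases hC.fin with ⟨h1, -, -⟩ | ⟨h1, -⟩
      · exact h1
      · simp [h] at h1
    intro x hx
    rcases hC.output x hx with h | h | ⟨h1, h2, h3⟩ | ⟨h1, h2, h3⟩
    · rcases hI.output x h with ⟨h1, h2⟩ | ⟨h1, ⟨h2, w, h3, h4⟩ | ⟨h2, h3, h4⟩⟩
      · exact .inl ⟨h1, hE.vOut _ h2⟩
      · exact .inr ⟨hE.vOut _ h1, .inl ⟨hE.s2 _ h2, w, hE.inp _ h3, h4⟩⟩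
      · exact .inr ⟨hE.vOut _ h1, .inr ⟨hE.correctSent h2, hE.oecFin h3, by rw [hfin h3, h4]⟩⟩
    · exact .inl h
    -- The output input must not be `none`, which would read as $\bot$. A positive second indicator
    -- gives $n-t>0$ links, and any link witnesses that an input is present.
    · have hne : ((s.ua .two).link1 C i).Nonempty := by
        rw [← Set.ncard_pos (Set.toFinite _)]
        have := hI.s1 (hI.s2 h2).1
        omega
      obtain ⟨-, w, -, -, hw, -⟩ := hne
      exact .inr ⟨hE.vOut _ h1, .inl ⟨hE.s2 _ h2, w, hE.inp _ hw, h3.trans hw⟩⟩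
    · exact .inr ⟨hE.vOut _ (hI.correctSent h1), .inr ⟨hE.correctSent h1, hE.oecFin h2,
        by rw [hfin h2, h3, (hI.oec_true h2).2]⟩⟩

end LocalInvariants

/-! ### From global steps to local facts: received implies justified -/

section Executions

variable {n k t : ℕ} {α : Type*} {C : ErrorCorrectingCode n k α} {F : Finset (Fin n)}
  {c c' : Config n k α} {ev : Event n k α}

theorem mem_sends {i src dst : Fin n} {m : Msg α} {out : Option (Fin n → Msg α)} :
    (src, dst, m) ∈ sends i out ↔ src = i ∧ ∃ f, out = some f ∧ m = f dst := by
  cases out with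
  | none => simp [sends]
  | some f => simp [sends]; grind

/-- No honesty of `i` is needed: a dishonest node sends without changing its recorded state and so
only stutters. -/
theorem Step.localStep (h : Step C t F c ev c') (i : Fin n) :
    ∃ out, LocalStep C t i c.net (c.node i) out (c'.node i) ∧
      ∀ f, out = some f → ∀ j, (i, j, f j) ∈ c'.net := by
  have other : ∀ {l : Fin n} {s : NodeState n k α}, i ≠ l →
      ∃ out, LocalStep C t i c.net (c.node i) out (Function.update c.node l s i) ∧
        ∀ f, out = some f → ∀ j, (i, j, f j) ∈ c'.net := by
    intro l s hl
    rw [Function.update_of_ne hl]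
    exact ⟨none, .stutter _, by simp⟩
  have own : ∀ {out : Option (Fin n → Msg α)} (f), out = some f → ∀ j,
      (i, j, f j) ∈ c.net + sends i out := fun f hf j =>
    Multiset.mem_add.mpr (.inr (mem_sends.mpr ⟨rfl, f, hf, rfl⟩))
  cases h
  case act l out s' hl hc =>
    by_cases h : i = l
    · subst h
      exact ⟨out, by simpa [Config.setNode] using .clause _ _ _ hc, own⟩
    · exact other h
  case recv src dst m net' hd hq hm =>
    by_cases h : i = dst
    · subst h
      exact ⟨none, by simpa [Config.setNode] using .receive _ _ _ hq (by simp [hm]), by simp⟩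
    · exact other h
  case input l w hl hq ho hn =>
    by_cases h : i = l
    · subst h
      exact ⟨_, by simpa [Config.setNode] using .input _ w, own⟩
    · exact other h
  case abba l b hl hq ho hn =>
    by_cases h : i = l
    · subst h
      exact ⟨_, by simpa [Config.setNode] using .abba _ b ho hn, own⟩
    · exact other h
  case byz => exact ⟨none, .stutter _, by simp⟩
  case idle => exact ⟨none, .stutter _, by simp⟩

theorem Step.mem_net (h : Step C t F c ev c') {src dst : Fin n} {m : Msg α} (hs : src ∉ F)
    (hm : (src, dst, m) ∈ c'.net) : (src, dst, m) ∈ c.net ∨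
      ∃ f, LocalStep C t src c.net (c.node src) (some f) (c'.node src) ∧ m = f dst := by
  cases h
  case act l out s' hl hc =>
    rcases Multiset.mem_add.mp hm with h | h
    · exact .inl h
    · obtain ⟨rfl, f, rfl, rfl⟩ := mem_sends.mp h
      exact .inr ⟨f, by simpa [Config.setNode] using .clause _ _ _ hc, rfl⟩
  case recv src' dst' m' net' hd hq hm' =>
    left
    rw [hm']
    exact Multiset.mem_cons_of_mem hm
  case input l w hl hq ho hn =>
    rcases Multiset.mem_add.mp hm with h | h
    · exact .inl h
    · obtain ⟨rfl, f, hf, rfl⟩ := mem_sends.mp h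
      exact .inr ⟨f, by rw [← hf]; simpa [Config.setNode] using .input _ w, rfl⟩
  case abba l b hl hq ho hn =>
    rcases Multiset.mem_add.mp hm with h | h
    · exact .inl h
    · obtain ⟨rfl, f, hf, rfl⟩ := mem_sends.mp h
      exact .inr ⟨f, by rw [← hf]; simpa [Config.setNode] using .abba _ b ho hn, rfl⟩
  case byz src' dst' m' hs' =>
    rcases Multiset.mem_cons.mp hm with h | h
    · cases h; exact absurd hs' hs
    · exact .inl h
  case idle => exact .inl hm

namespace Execution

variable (e : Execution C t F) {i j src dst : Fin n}

theorem ext (i : Fin n) {T T' : ℕ} (h : T ≤ T') :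
    Ext ((e.cfg T).node i) ((e.cfg T').node i) := by
  induction T', h using Nat.le_induction with
  | base => exact Ext.refl _
  | succ T' _ ih =>
    obtain ⟨_, h, -⟩ := (e.step T').localStep i
    exact ih.trans h.ext

theorem nodeInv (hk : 1 ≤ k) (hn : t < n) (i : Fin n) (T : ℕ) :
    NodeInv C t i ((e.cfg T).node i) := by
  induction T with
  | zero => rw [e.start]; exact nodeInv_init C hk i
  | succ T ih =>
    obtain ⟨_, h, -⟩ := (e.step T).localStep i
    exact ih.step hn h

theorem justified_of_mem_net (hs : src ∉ F) {T : ℕ} {m : Msg α}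
    (hm : (src, dst, m) ∈ (e.cfg T).net) :
    Justified C t src dst ((e.cfg T).node src) m := by
  induction T with
  | zero => simp [e.start, Config.init] at hm
  | succ T ih =>
    rcases (e.step T).mem_net hs hm with h | ⟨f, h, rfl⟩
    · exact (ih h).mono (e.ext src T.le_succ)
    · exact h.justified dst

/-- A fact about the received messages is justified by the sender, if it was false initially and
can become true only when a message with this justification is in transit. -/
theorem justified_of_received (hs : src ∉ F) {m : Msg α}
    {P : NodeState n k α → Prop} (h₀ : ¬ P (NodeState.init n k α))
    (hP : ∀ {N s out s'}, Change C t dst N s out s' → P s' → P s ∨ (src, dst, m) ∈ N)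
    {T : ℕ} (h : P ((e.cfg T).node dst)) : Justified C t src dst ((e.cfg T).node src) m := by
  induction T with
  | zero => rw [e.start] at h; exact absurd h h₀
  | succ T ih =>
    obtain ⟨_, hl, -⟩ := (e.step T).localStep dst
    refine Justified.mono (e.ext src T.le_succ) ?_
    rcases hP hl.change h with h | h
    · exact ih h
    · exact e.justified_of_mem_net hs h

theorem sym_justified (hs : src ∉ F) {T : ℕ} {a b : α}
    (h : (((e.cfg T).node dst).ua .two).sym src = some (a, b)) :
    ∃ w, (((e.cfg T).node src).ua .two).inp = some w ∧ a = C.enc w dst ∧ b = C.enc w src :=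
  e.justified_of_received hs (m := .symbol .two a b)
    (P := fun s => (s.ua .two).sym src = some (a, b)) (by simp [NodeState.init, UAState.init])
    (fun hC => hC.sym src a b) h

theorem si1_justified (hs : src ∉ F) {T : ℕ} {b : Bool}
    (h : (((e.cfg T).node dst).ua .two).si1 src = some b) :
    (((e.cfg T).node src).ua .two).s1 = some b :=
  e.justified_of_received hs (m := .si1 .two b)
    (P := fun s => (s.ua .two).si1 src = some b) (by simp [NodeState.init, UAState.init])
    (fun hC => hC.si1 src b) h

theorem si2_justified (hs : src ∉ F) {T : ℕ} {b : Bool}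
    (h : (((e.cfg T).node dst).ua .two).si2 src = some b) :
    (((e.cfg T).node src).ua .two).s2 = some b :=
  e.justified_of_received hs (m := .si2 .two b)
    (P := fun s => (s.ua .two).si2 src = some b) (by simp [NodeState.init, UAState.init])
    (fun hC => hC.si2 src b) h

theorem ready_justified (hs : src ∉ F) {T : ℕ} {v : Bool}
    (h : src ∈ ((e.cfg T).node dst).ready v) : v ∈ ((e.cfg T).node src).readySent :=
  e.justified_of_received hs (m := .ready v)
    (P := fun s => src ∈ s.ready v) (by simp [NodeState.init])
    (fun hC => hC.ready src v) h

theorem symFin_justified (hs : src ∉ F) {T : ℕ} {y : α}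
    (h : ((e.cfg T).node dst).symFin src = some y) :
    t + 1 ≤ ((((e.cfg T).node src).ua .two).votes y ∩
      (((e.cfg T).node src).ua .two).set2 true).ncard ∨
    (∃ w, (((e.cfg T).node src).ua .two).inp = some w ∧ y = C.enc w src) ∧
      (((e.cfg T).node src).ua .two).s2 = some true := by
  -- Splitting at the final time suffices: by monotonicity, if this source is absent now, it was
  -- absent when the symbol was collected, which leaves only CORRECTSYMBOL.
  by_cases hlocal : ∃ a, (((e.cfg T).node dst).ua .two).sym src = some (a, y) ∧
      (((e.cfg T).node dst).ua .two).si2 src = some true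
  · obtain ⟨a, h1, h2⟩ := hlocal
    obtain ⟨w, hw, -, hy⟩ := e.sym_justified hs h1
    exact .inr ⟨⟨w, hw, hy⟩, e.si2_justified hs h2⟩
  · left
    have : Justified C t src dst ((e.cfg T).node src) (.correctSymbol y) := by
      induction T with
      | zero => simp [e.start, Config.init, NodeState.init] at h
      | succ T ih =>
        obtain ⟨_, hl, -⟩ := (e.step T).localStep dst
        have hE := e.ext dst T.le_succ
        have hlocal' : ¬ ∃ a, (((e.cfg T).node dst).ua .two).sym src = some (a, y) ∧
            (((e.cfg T).node dst).ua .two).si2 src = some true :=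
          fun ⟨a, h1, h2⟩ => hlocal ⟨a, hE.sym _ _ h1, hE.si2 _ _ h2⟩
        refine Justified.mono (e.ext src T.le_succ) ?_
        rcases hl.change.symFin _ _ h with h | h | h
        · exact ih h hlocal'
        · exact absurd h hlocal'
        · exact e.justified_of_mem_net hs h
    exact this

end Execution
end Executions

/-! ### Delivery and fairness: sent implies eventually recorded -/

section Receive

variable {n k : ℕ} {α : Type*} (C : ErrorCorrectingCode n k α) (t : ℕ) {s : NodeState n k α}

theorem receive_symbol (ho : s.output = none) (j : Fin n) (a b : α) :
    ((s.receive C t j (.symbol .two a b)).ua .two).sym j ≠ none := by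
  by_cases h : (s.ua .two).sym j = none <;> simp [NodeState.receive, ho, h, NodeState.setUA]

theorem receive_si2 (ho : s.output = none) (j : Fin n) (b : Bool) :
    ((s.receive C t j (.si2 .two b)).ua .two).si2 j ≠ none := by
  by_cases h : (s.ua .two).si2 j = none <;> simp [NodeState.receive, ho, h, NodeState.setUA]

theorem receive_ready (ho : s.output = none) (j : Fin n) (v : Bool) :
    j ∈ (s.receive C t j (.ready v)).ready v := by
  simp [NodeState.receive, ho]

/-- The second alternative is needed because symbols arriving after a successful decoding are
ignored. -/
theorem receive_correctSymbol (ho : s.output = none) (j : Fin n) (y : α) :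
    (s.receive C t j (.correctSymbol y)).symFin j ≠ none ∨
      (s.receive C t j (.correctSymbol y)).oecFin = true := by
  by_cases h : s.symFin j = none ∧ s.oecFin = false
  · left
    obtain ⟨d, o, hd, -⟩ := addFin_eq C t s j y
    simp [NodeState.receive, ho, h, hd]
  · simp only [NodeState.receive, ho, h]
    simp only [not_and, Bool.not_eq_false] at h
    simpa [or_iff_not_imp_left] using h

end Receive

/-- Turns every threshold of the protocol into a number of honest nodes. -/
theorem card_sdiff_add_le {n : ℕ} (F : Finset (Fin n)) (S : Set (Fin n)) :
    ∃ L : Finset (Fin n), (∀ j ∈ L, j ∉ F ∧ j ∈ S) ∧ S.ncard ≤ L.card + F.card := by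
  classical
  refine ⟨S.toFinite.toFinset \ F, fun j hj => ?_, ?_⟩
  · simpa [and_comm] using hj
  · rw [Set.ncard_eq_toFinset_card S]
    exact Nat.sub_le_iff_le_add.mp (Finset.le_card_sdiff _ _)

namespace Execution

variable {n k t : ℕ} {α : Type*} {C : ErrorCorrectingCode n k α} {F : Finset (Fin n)}
variable (e : Execution C t F) {i j src dst : Fin n}

open Filter

/-- The source of all liveness: at such a time, a clause whose guard is implied by `P` cannot be
enabled, so its effect has already taken place. -/
theorem exists_quiescent (hi : i ∉ F) {P : ℕ → Prop} (h : ∀ᶠ T in atTop, P T) :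
    ∃ T, P T ∧ Quiescent C t i ((e.cfg T).node i) := by
  have h' : ∃ᶠ T in atTop, Quiescent C t i ((e.cfg T).node i) :=
    frequently_atTop.mpr fun T => e.progress i hi T
  obtain ⟨T, h1, h2⟩ := (h'.and_eventually h).exists
  exact ⟨T, h2, h1⟩

theorem exists_receive (hs : src ∉ F) (hd : dst ∉ F) {T : ℕ} {m : Msg α}
    (hm : (src, dst, m) ∈ (e.cfg T).net) :
    ∃ T', (e.cfg (T' + 1)).node dst = ((e.cfg T').node dst).receive C t src m := by
  obtain ⟨T', -, h⟩ := e.reliable src hs dst hd m T hm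
  have hstep := e.step T'
  rw [h] at hstep
  refine ⟨T', ?_⟩
  generalize e.cfg (T' + 1) = c' at hstep
  cases hstep
  simp [Config.setNode]

/-- A fact about the state of an honest node that only becomes true when the node sends a message
`m` is accompanied by such a message in transit. -/
theorem exists_mem_net (src dst : Fin n) {P : NodeState n k α → Prop}
    {Q : Msg α → Prop} (h₀ : ¬ P (NodeState.init n k α))
    (hP : ∀ {N s out s'}, Change C t src N s out s' → P s' →
      P s ∨ ∃ f, out = some f ∧ Q (f dst))
    {T : ℕ} (h : P ((e.cfg T).node src)) : ∃ m T', Q m ∧ (src, dst, m) ∈ (e.cfg T').net := by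
  induction T with
  | zero => rw [e.start] at h; exact absurd h h₀
  | succ T ih =>
    obtain ⟨_, hl, hnet⟩ := (e.step T).localStep src
    rcases hP hl.change h with h | ⟨f, hf, hQ⟩
    · exact ih h
    · exact ⟨f dst, T + 1, hQ, hnet f hf dst⟩

/-- Delivery only shows that some pair from `src` is recorded, since the first one counts. Its value
is then fixed by `sym_justified`, as the input of `src` never changes. Here `ho` is essential: a
terminated node ignores messages. -/
theorem eventually_sym (hs : src ∉ F) (hd : dst ∉ F)
    (ho : ∀ T, ((e.cfg T).node dst).output = none) {T : ℕ} {w : Fin k → α}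
    (h : (((e.cfg T).node src).ua .two).inp = some w) :
    ∀ᶠ T' in atTop, (((e.cfg T').node dst).ua .two).sym src =
      some (C.enc w dst, C.enc w src) := by
  obtain ⟨m, T', hm, hnet⟩ := e.exists_mem_net src dst
    (P := fun s => (s.ua .two).inp = some w) (Q := fun m => ∃ a b, m = .symbol .two a b)
    (by simp [NodeState.init, UAState.init])
    (fun hC hw => (hC.inp w hw).imp id fun h => ⟨_, h, _, _, rfl⟩) h
  obtain ⟨a, b, rfl⟩ := hm
  obtain ⟨T₁, h₁⟩ := e.exists_receive hs hd hnet
  have h₂ := receive_symbol C t (ho T₁) src a b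
  rw [← h₁] at h₂
  obtain ⟨⟨a', b'⟩, h₃⟩ := Option.ne_none_iff_exists'.mp h₂
  filter_upwards [eventually_ge_atTop (T₁ + 1), eventually_ge_atTop T] with T₂ hT₂ hT
  have h₄ := (e.ext dst hT₂).sym _ _ h₃
  obtain ⟨w', hw', rfl, rfl⟩ := e.sym_justified hs h₄
  obtain rfl : w' = w := Option.some.inj (hw'.symm.trans ((e.ext src hT).inp _ h))
  exact h₄

theorem eventually_si2 (hs : src ∉ F) (hd : dst ∉ F)
    (ho : ∀ T, ((e.cfg T).node dst).output = none) {T : ℕ} {b : Bool}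
    (h : (((e.cfg T).node src).ua .two).s2 = some b) :
    ∀ᶠ T' in atTop, (((e.cfg T').node dst).ua .two).si2 src = some b := by
  obtain ⟨m, T', rfl, hnet⟩ := e.exists_mem_net src dst
    (P := fun s => (s.ua .two).s2 = some b) (Q := fun m => m = .si2 .two b)
    (by simp [NodeState.init, UAState.init])
    (fun hC hw => (hC.s2 b hw).imp id fun h => ⟨_, h.1, rfl⟩) h
  obtain ⟨T₁, h₁⟩ := e.exists_receive hs hd hnet
  have h₂ := receive_si2 C t (ho T₁) src b
  rw [← h₁] at h₂
  obtain ⟨b', h₃⟩ := Option.ne_none_iff_exists'.mp h₂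
  filter_upwards [eventually_ge_atTop (T₁ + 1), eventually_ge_atTop T] with T₂ hT₂ hT
  have h₄ := (e.ext dst hT₂).si2 _ _ h₃
  rw [h₄, ← e.si2_justified hs h₄, (e.ext src hT).s2 _ h]

theorem eventually_ready (hs : src ∉ F) (hd : dst ∉ F)
    (ho : ∀ T, ((e.cfg T).node dst).output = none) {T : ℕ} {v : Bool}
    (h : v ∈ ((e.cfg T).node src).readySent) :
    ∀ᶠ T' in atTop, src ∈ ((e.cfg T').node dst).ready v := by
  obtain ⟨m, T', rfl, hnet⟩ := e.exists_mem_net src dst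
    (P := fun s => v ∈ s.readySent) (Q := fun m => m = .ready v) (by simp [NodeState.init])
    (fun hC hw => (hC.readySent v hw).imp id fun h => ⟨_, h.1, rfl⟩) h
  obtain ⟨T₁, h₁⟩ := e.exists_receive hs hd hnet
  have h₂ := receive_ready C t (ho T₁) src v
  rw [← h₁] at h₂
  filter_upwards [eventually_ge_atTop (T₁ + 1)] with T₂ hT₂
  exact (e.ext dst hT₂).ready v h₂

theorem eventually_symFin_of_correctSent (hs : src ∉ F) (hd : dst ∉ F)
    (ho : ∀ T, ((e.cfg T).node dst).output = none) {T : ℕ}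
    (h : ((e.cfg T).node src).correctSent = true) :
    ∀ᶠ T' in atTop, ((e.cfg T').node dst).symFin src ≠ none ∨
      ((e.cfg T').node dst).oecFin = true := by
  obtain ⟨m, T', ⟨y, rfl⟩, hnet⟩ := e.exists_mem_net src dst
    (P := fun s => s.correctSent = true) (Q := fun m => ∃ y, m = .correctSymbol y)
    (by simp [NodeState.init])
    (fun hC hw => (hC.correctSent hw).imp id fun ⟨_, y, h⟩ => ⟨_, h, y, rfl⟩) h
  obtain ⟨T₁, h₁⟩ := e.exists_receive hs hd hnet
  have h₂ := receive_correctSymbol C t (ho T₁) src y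
  rw [← h₁] at h₂
  filter_upwards [eventually_ge_atTop (T₁ + 1)] with T₂ hT₂
  have hE := e.ext dst hT₂
  refine h₂.imp (fun h => ?_) hE.oecFin
  obtain ⟨z, hz⟩ := Option.ne_none_iff_exists'.mp h
  simp [hE.symFin _ _ hz]

theorem eventually_symFin_of_s2 (hs : src ∉ F) (hd : dst ∉ F)
    (ho : ∀ T, ((e.cfg T).node dst).output = none) {T : ℕ} {w : Fin k → α}
    (h : (((e.cfg T).node src).ua .two).inp = some w)
    (h' : (((e.cfg T).node src).ua .two).s2 = some true) :
    ∀ᶠ T' in atTop, ((e.cfg T').node dst).symFin src ≠ none ∨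
      ((e.cfg T').node dst).oecFin = true := by
  obtain ⟨T₁, ⟨h₁, h₂⟩, hq⟩ := e.exists_quiescent hd
    ((e.eventually_sym hs hd ho h).and (e.eventually_si2 hs hd ho h'))
  have h₃ : ((e.cfg T₁).node dst).symFin src ≠ none ∨ ((e.cfg T₁).node dst).oecFin = true := by
    by_contra! hc
    exact hq _ _ (.collectFin _ src _ _ (ho T₁) h₁ h₂ hc.1 (by simpa using hc.2))
  filter_upwards [eventually_ge_atTop T₁] with T₂ hT₂
  have hE := e.ext dst hT₂
  refine h₃.imp (fun h => ?_) hE.oecFin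
  obtain ⟨z, hz⟩ := Option.ne_none_iff_exists'.mp h
  simp [hE.symFin _ _ hz]

/-! ### Binary reliable agreement -/

theorem abbaOut_of_readySent (hF : F.card ≤ t) (T : ℕ) : ∀ {i v}, i ∉ F →
    v ∈ ((e.cfg T).node i).readySent → ∃ j ∉ F, ∃ T', ((e.cfg T').node j).abbaOut = some v := by
  induction T with
  | zero => intro i v _ h; simp [e.start, Config.init, NodeState.init] at h
  | succ T ih =>
    intro i v hi h
    obtain ⟨_, hl, -⟩ := (e.step T).localStep i
    rcases hl.change.readySent v h with h | ⟨-, h | h⟩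
    · exact ih hi h
    · exact ⟨i, hi, _, h⟩
    · obtain ⟨L, hL, hc⟩ := card_sdiff_add_le F (((e.cfg T).node i).ready v : Set (Fin n))
      rw [Set.ncard_coe_finset] at hc
      obtain ⟨j, hj⟩ := Finset.card_pos.mp (by omega : 0 < L.card)
      exact ih (hL j hj).1 (e.ready_justified (hL j hj).1 (hL j hj).2)

variable {e}

theorem readySent_unique (habba : ABBACorrect e) (hF : F.card ≤ t) (hi : i ∉ F) (hj : j ∉ F)
    {T T' : ℕ} {v v' : Bool} (h : v ∈ ((e.cfg T).node i).readySent)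
    (h' : v' ∈ ((e.cfg T').node j).readySent) : v = v' := by
  obtain ⟨l, hl, S, hS⟩ := e.abbaOut_of_readySent hF T hi h
  obtain ⟨l', hl', S', hS'⟩ := e.abbaOut_of_readySent hF T' hj h'
  exact habba.consistency l hl l' hl' (max S S') v v'
    ((e.ext l (le_max_left _ _)).abbaOut _ hS) ((e.ext l' (le_max_right _ _)).abbaOut _ hS')

/-- Since $2t+1>t+1$, the node has already sent some READY. One of the READY `v` it received is
honest, so its own value is `v` as well. -/
theorem readySent_of_vOut (habba : ABBACorrect e) (hk : 1 ≤ k) (hkt : 3 * k ≤ t)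
    (hn : 3 * t + 1 ≤ n) (hF : F.card ≤ t) (hi : i ∉ F) {T : ℕ} {v : Bool}
    (h : ((e.cfg T).node i).vOut = some v) : v ∈ ((e.cfg T).node i).readySent := by
  have hI := e.nodeInv hk (by omega) i T
  have h1 := hI.vOut v h
  obtain ⟨u, hu⟩ := Finset.nonempty_iff_ne_empty.mpr (hI.readyCard v (by omega))
  obtain ⟨L, hL, hc⟩ := card_sdiff_add_le F (((e.cfg T).node i).ready v : Set (Fin n))
  rw [Set.ncard_coe_finset] at hc
  obtain ⟨j, hj⟩ := Finset.card_pos.mp (by omega : 0 < L.card)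
  rwa [readySent_unique habba hF (hL j hj).1 hi
    (e.ready_justified (hL j hj).1 (hL j hj).2) hu]

theorem exists_vOut_of_output (hk : 1 ≤ k) (hn : t < n) {T : ℕ}
    (h : ((e.cfg T).node i).output ≠ none) : ∃ v, ((e.cfg T).node i).vOut = some v := by
  obtain ⟨x, hx⟩ := Option.ne_none_iff_exists'.mp h
  rcases (e.nodeInv hk hn i T).output x hx with ⟨-, h⟩ | ⟨h, -⟩ <;> exact ⟨_, h⟩

theorem eventually_card_ready {L : Finset (Fin n)} {v : Bool} (hj : j ∉ F)
    (ho : ∀ T, ((e.cfg T).node j).output = none)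
    (hL : ∀ l ∈ L, l ∉ F ∧ ∃ T, v ∈ ((e.cfg T).node l).readySent) :
    ∀ᶠ T in atTop, L.card ≤ (((e.cfg T).node j).ready v).card := by
  have : ∀ᶠ T in atTop, ∀ l ∈ L, l ∈ ((e.cfg T).node j).ready v :=
    (Finset.eventually_all L).mpr fun l hl =>
      e.eventually_ready (hL l hl).1 hj ho (hL l hl).2.choose_spec
  filter_upwards [this] with T hT
  exact Finset.card_le_card hT

theorem exists_vOut (habba : ABBACorrect e) (hk : 1 ≤ k) (hkt : 3 * k ≤ t)
    (hn : 3 * t + 1 ≤ n) (hF : F.card ≤ t) (hi : i ∉ F) {T : ℕ} {v : Bool}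
    (h : ((e.cfg T).node i).vOut = some v) (hj : j ∉ F) :
    ∃ T', ((e.cfg T').node j).vOut = some v := by
  classical
  have htn : t < n := by omega
  have hv := readySent_of_vOut habba hk hkt hn hF hi h
  obtain ⟨L, hL, hc⟩ := card_sdiff_add_le F (((e.cfg T).node i).ready v : Set (Fin n))
  rw [Set.ncard_coe_finset] at hc
  have h1 := (e.nodeInv hk htn i T).vOut v h
  -- A running node hears $t+1$ honest READY messages and amplifies unless it has sent one already;
  -- a terminated node had decided, hence had sent READY. Uniqueness identifies the value.
  have all : ∀ l ∉ F, ∃ T', v ∈ ((e.cfg T').node l).readySent := by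
    intro l hl
    by_cases ho : ∀ T, ((e.cfg T).node l).output = none
    · obtain ⟨T', h2, hq⟩ := e.exists_quiescent hl (eventually_card_ready hl ho fun m hm =>
        ⟨(hL m hm).1, T, e.ready_justified (hL m hm).1 (hL m hm).2⟩)
      have h3 : ((e.cfg T').node l).readySent ≠ ∅ := fun h3 =>
        hq _ _ (.readyAmplify _ v (ho T') (by omega) h3)
      obtain ⟨u, hu⟩ := Finset.nonempty_iff_ne_empty.mpr h3
      exact ⟨T', by rwa [readySent_unique habba hF hi hl hv hu]⟩
    · push Not at ho
      obtain ⟨T', hT'⟩ := ho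
      obtain ⟨u, hu⟩ := exists_vOut_of_output hk htn hT'
      have hu := readySent_of_vOut habba hk hkt hn hF hl hu
      exact ⟨T', by rwa [readySent_unique habba hF hi hl hv hu]⟩
  have key : ∃ T' u, ((e.cfg T').node j).vOut = some u := by
    by_cases ho : ∀ T, ((e.cfg T).node j).output = none
    · have hcard : Fᶜ.card = n - F.card := by simp [Finset.card_compl]
      obtain ⟨T', h2, hq⟩ := e.exists_quiescent hj (eventually_card_ready (L := Fᶜ) hj ho
        fun m hm => ⟨Finset.mem_compl.mp hm, all m (Finset.mem_compl.mp hm)⟩)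
      refine ⟨T', Option.ne_none_iff_exists'.mp fun h3 => ?_⟩
      cases v with
      | false => exact hq _ _ (.setZero _ (ho T') (by omega) h3)
      | true => exact hq _ _ (.setOne _ (ho T') (by omega) h3)
    · push Not at ho
      obtain ⟨T', hT'⟩ := ho
      exact ⟨T', exists_vOut_of_output hk htn hT'⟩
  obtain ⟨T', u, hu⟩ := key
  have := readySent_unique habba hF hi hj hv (readySent_of_vOut habba hk hkt hn hF hj hu)
  exact ⟨T', this ▸ hu⟩

/-! ### Unique agreement -/

theorem exists_linked {T : ℕ} {S : Set (Fin n)}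
    (hF : F.card ≤ t) (hn : 2 * t < n)
    (hS : S ⊆ (((e.cfg T).node i).ua .two).link1 C i) (hc : n - t ≤ S.ncard) :
    ∃ w, (((e.cfg T).node i).ua .two).inp = some w ∧ ∃ L : Finset (Fin n),
      (∀ j ∈ L, j ∉ F ∧ j ∈ S) ∧ n ≤ L.card + F.card + t ∧
      ∀ j ∈ L, Linked C (fun j => (((e.cfg T).node j).ua .two).inp) i w j := by
  obtain ⟨L, hL, hLc⟩ := card_sdiff_add_le F S
  obtain ⟨l, hl⟩ := Finset.card_pos.mp (by omega : 0 < L.card)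
  obtain ⟨w, -, -, hw, -⟩ := hS (hL l hl).2
  refine ⟨w, hw, L, hL, by omega, fun j hj => ?_⟩
  obtain ⟨w', a, b, hw', hsym, rfl, rfl⟩ := hS (hL j hj).2
  obtain rfl : w' = w := Option.some.inj (hw'.symm.trans hw)
  obtain ⟨u, hu, h1, h2⟩ := e.sym_justified (hL j hj).1 hsym
  exact ⟨u, hu, h1.symm, h2.symm⟩

/-- The ABBA input 1 supplies the $t+1$ honest positive indicators that `unique_of_linked` requires.
It is applied to a snapshot at a time after `T₀`; persistence of inputs and indicators extends the
conclusion to all times. -/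
theorem exists_inp_of_s2 (hk : 1 ≤ k) (hkt : 3 * k ≤ t) (hn : 3 * t + 1 ≤ n) (hF : F.card ≤ t)
    {i₀ : Fin n} {T₀ : ℕ} (h₀ : ((e.cfg T₀).node i₀).abbaIn = some true) :
    ∃ w, (∀ i ∉ F, ∀ T, (((e.cfg T).node i).ua .two).s2 = some true →
      (((e.cfg T).node i).ua .two).inp = some w) ∧
      ∃ L : Finset (Fin n), t + 1 ≤ L.card ∧
        ∀ j ∈ L, j ∉ F ∧ (((e.cfg T₀).node j).ua .two).s2 = some true := by
  classical
  have htn : t < n := by omega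
  have inv := fun i T => e.nodeInv hk htn i T
  obtain ⟨L, hL, hLc⟩ := card_sdiff_add_le F ((((e.cfg T₀).node i₀).ua .two).set2 true)
  have h1 := (inv i₀ T₀).abbaIn h₀
  have hL2 : ∀ j ∈ L, j ∉ F ∧ (((e.cfg T₀).node j).ua .two).s2 = some true := fun j hj =>
    ⟨(hL j hj).1, e.si2_justified (hL j hj).1 (hL j hj).2⟩
  have hcard : Fᶜ.card = n - F.card := by simp [Finset.card_compl]
  have link1 : ∀ {i}, i ∉ F → ∀ {T}, (((e.cfg T).node i).ua .two).s1 = some true → _ :=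
    fun {i} hi {T} h => exists_linked hF (by omega) subset_rfl ((inv i T).s1 h)
  have link2 : ∀ {i}, i ∉ F → ∀ {T}, (((e.cfg T).node i).ua .two).s2 = some true → _ :=
    fun {i} hi {T} h => exists_linked hF (by omega) Set.inter_subset_right
      ((inv i T).s2 h).2
  have agree : ∀ {i j}, i ∉ F → j ∉ F → ∀ {T}, T₀ ≤ T →
      (((e.cfg T).node i).ua .two).s2 = some true →
      (((e.cfg T).node j).ua .two).s2 = some true →
      (((e.cfg T).node i).ua .two).inp = (((e.cfg T).node j).ua .two).inp := by
    intro i j hi hj T hT h2 h2'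
    refine unique_of_linked (x := fun j => (((e.cfg T).node j).ua .two).inp) (t := t) (H := Fᶜ)
      (V₁ := Fᶜ.filter fun j => (((e.cfg T).node j).ua .two).s1 = some true)
      (V₂ := Fᶜ.filter fun j => (((e.cfg T).node j).ua .two).s2 = some true)
      hkt C (by omega) (Finset.filter_subset _ _) ?_ ?_ ?_ ?_ (by simp [hi, h2]) (by simp [hj, h2'])
    · intro l hl
      simp only [Finset.mem_filter, Finset.mem_compl] at hl ⊢
      exact ⟨hl.1, ((inv l T).s2 hl.2).1⟩
    · intro l hl
      simp only [Finset.mem_filter, Finset.mem_compl] at hl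
      obtain ⟨w, hw, M, hM, hc, hlk⟩ := link1 hl.1 hl.2
      exact ⟨w, hw, M, fun m hm => by simpa using (hM m hm).1, by omega, hlk⟩
    · intro l hl
      simp only [Finset.mem_filter, Finset.mem_compl] at hl
      obtain ⟨w, hw, M, hM, hc, hlk⟩ := link2 hl.1 hl.2
      refine ⟨w, hw, M, fun m hm => ?_, by omega, hlk⟩
      -- The links counted in Phase 2 go to senders of a positive SI1, so they stay inside `V₁`.
      simpa [(hM m hm).1] using e.si1_justified (hM m hm).1 (hM m hm).2.1
    · refine le_trans (by omega : t + 1 ≤ L.card) (Finset.card_le_card fun l hl => ?_)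
      simpa [(hL2 l hl).1] using (e.ext l hT).s2 _ (hL2 l hl).2
  obtain ⟨l, hl⟩ := Finset.card_pos.mp (by omega : 0 < L.card)
  obtain ⟨w, hw, -⟩ := link2 (hL2 l hl).1 (hL2 l hl).2
  refine ⟨w, fun i hi T h => ?_, L, by omega, hL2⟩
  obtain ⟨u, hu, -⟩ := link2 hi h
  have h3 := agree hi (hL2 l hl).1 (le_max_right T T₀)
    ((e.ext i (le_max_left T T₀)).s2 _ h)
    ((e.ext l (le_max_right T T₀)).s2 _ (hL2 l hl).2)
  rw [(e.ext i (le_max_left T T₀)).inp _ hu,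
    (e.ext l (le_max_right T T₀)).inp _ hw] at h3
  exact hu.trans h3

/-! ### Multicast -/

/-- A CORRECTSYMBOL rests on $t+1$ votes with positive SI2, one of them from an honest node, which
holds `w`. Otherwise `src` itself has a positive second indicator and holds `w`. -/
theorem symFin_eq (hF : F.card ≤ t) {w : Fin k → α}
    (hw : ∀ i ∉ F, ∀ T, (((e.cfg T).node i).ua .two).s2 = some true →
      (((e.cfg T).node i).ua .two).inp = some w)
    (hs : src ∉ F) {T : ℕ} {y : α}
    (h : ((e.cfg T).node dst).symFin src = some y) : y = C.enc w src := by
  rcases e.symFin_justified hs h with h | ⟨⟨u, hu, hy⟩, h2⟩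
  · obtain ⟨L, hL, hc⟩ := card_sdiff_add_le F ((((e.cfg T).node src).ua .two).votes y ∩
      (((e.cfg T).node src).ua .two).set2 true)
    obtain ⟨l, hl⟩ := Finset.card_pos.mp (by omega : 0 < L.card)
    obtain ⟨hlF, ⟨b, hb⟩, h2⟩ := hL l hl
    obtain ⟨u, hu, hy, -⟩ := e.sym_justified hlF hb
    rw [hw l hlF T (e.si2_justified hlF h2)] at hu
    rw [hy, Option.some.inj hu]
  · rw [hw src hs T h2] at hu
    rw [hy, Option.some.inj hu]

/-- Of the `k + t` matching symbols at least `k` come from honest nodes and belong to `w`, which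
determines the message. -/
theorem dec_symFin_eq (hF : F.card ≤ t) {w : Fin k → α}
    (hw : ∀ i ∉ F, ∀ T, (((e.cfg T).node i).ua .two).s2 = some true →
      (((e.cfg T).node i).ua .two).inp = some w)
    {T : ℕ} (h : OECSucceeds C t ((e.cfg T).node dst).symFin) :
    C.dec ((e.cfg T).node dst).symFin = w := by
  obtain ⟨L, hL, hc⟩ := card_sdiff_add_le F {j | ((e.cfg T).node dst).symFin j =
    some (C.enc (C.dec ((e.cfg T).node dst).symFin) j)}
  have h2 := h.2
  exact C.eq_of_agree (S := L) (by omega) fun j hj => symFin_eq hF hw (hL j hj).1 (hL j hj).2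

theorem oecSucceeds_of_symFin (hkt : 3 * k ≤ t) (hn : 3 * t + 1 ≤ n) (hF : F.card ≤ t)
    {w : Fin k → α} {y : Fin n → Option α} (h : ∀ j ∉ F, y j = some (C.enc w j)) :
    OECSucceeds C t y := by
  have hcard : ((Fᶜ : Finset (Fin n)) : Set (Fin n)).ncard = n - F.card := by
    rw [Set.ncard_coe_finset]; simp [Finset.card_compl]
  have h1 : n - F.card ≤ {j | y j = some (C.enc w j)}.ncard := by
    rw [← hcard]
    exact Set.ncard_le_ncard (fun j hj => h j (by simpa using hj)) (Set.toFinite _)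
  have h2 : {j | ∃ a, y j = some a ∧ a ≠ C.enc w j}.ncard ≤ F.card := by
    rw [← Set.ncard_coe_finset F]
    refine Set.ncard_le_ncard (fun j hj => ?_) (Set.toFinite _)
    obtain ⟨a, ha, hne⟩ := hj
    by_contra hjF
    rw [h j (by simpa using hjF)] at ha
    exact hne (Option.some.inj ha).symm
  have h3 : {j | ∃ a, y j = some a ∧ a ≠ C.enc w j}.ncard +
      {j | y j = some (C.enc w j)}.ncard ≤ {j | y j ≠ none}.ncard := by
    rw [← Set.ncard_union_eq _ (Set.toFinite _) (Set.toFinite _)]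
    · refine Set.ncard_le_ncard (fun j hj => ?_) (Set.toFinite _)
      rcases hj with ⟨a, ha, -⟩ | ha
      · exact fun h => by simp [ha] at h
      · exact fun h => by simp [show y j = _ from ha] at h
    · rw [Set.disjoint_left]
      rintro j ⟨a, ha, hne⟩ ha'
      exact hne (Option.some.inj (ha.symm.trans ha'))
  -- With $e\le t$ errors and at least $2t+1$ correct symbols, $2e+k\le e+(2t+1)$ because $k\le t$.
  have hdec : C.dec y = w := C.dec_correct w y (by omega)
  refine ⟨by omega, ?_⟩
  rw [hdec]
  omega

theorem output_eq (hk : 1 ≤ k) (hn : t < n) (hF : F.card ≤ t) {w : Fin k → α}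
    (hw : ∀ i ∉ F, ∀ T, (((e.cfg T).node i).ua .two).s2 = some true →
      (((e.cfg T).node i).ua .two).inp = some w)
    (hi : i ∉ F) {T : ℕ} (hv : ((e.cfg T).node i).vOut = some true)
    {x : Option (Fin k → α)} (h : ((e.cfg T).node i).output = some x) : x = some w := by
  have hI := e.nodeInv hk hn i T
  rcases hI.output x h with ⟨-, h1⟩ | ⟨-, ⟨h1, u, hu, hx⟩ | ⟨-, h1, hx⟩⟩
  · simp [hv] at h1
  · rw [hx, ← hu, hw i hi T h1]
  · rw [hx, dec_symFin_eq hF hw (hI.oec_true h1).1]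

/-- The symbols and SI2 messages of the $t+1$ nodes in `L` all arrive and agree on the symbol of `w`
at `j`, which enables the correction once `j` waits. -/
theorem exists_correctSent {w : Fin k → α}
    (hw : ∀ i ∉ F, ∀ T, (((e.cfg T).node i).ua .two).s2 = some true →
      (((e.cfg T).node i).ua .two).inp = some w)
    {L : Finset (Fin n)} (hc : t + 1 ≤ L.card) {T₀ : ℕ}
    (hL : ∀ j ∈ L, j ∉ F ∧ (((e.cfg T₀).node j).ua .two).s2 = some true)
    (hj : j ∉ F) (ho : ∀ T, ((e.cfg T).node j).output = none) {T : ℕ}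
    (hv : ((e.cfg T).node j).vOut = some true) : ∃ T', ((e.cfg T').node j).correctSent = true := by
  have hrec : ∀ᶠ T' in atTop, ∀ l ∈ L, (((e.cfg T').node j).ua .two).sym l =
      some (C.enc w j, C.enc w l) ∧ (((e.cfg T').node j).ua .two).si2 l = some true :=
    (Finset.eventually_all L).mpr fun l hl =>
      (e.eventually_sym (hL l hl).1 hj ho (hw l (hL l hl).1 T₀ (hL l hl).2)).and
        (e.eventually_si2 (hL l hl).1 hj ho (hL l hl).2)
  obtain ⟨T', ⟨h1, h2⟩, hq⟩ := e.exists_quiescent hj (hrec.and (eventually_ge_atTop T))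
  have hv' := (e.ext j h2).vOut _ hv
  have hwait : ((e.cfg T').node j).waiting = true := by
    by_contra hwait
    rw [Bool.not_eq_true] at hwait
    by_cases hd : (((e.cfg T').node j).ua .two).v ≠ none ∧
        (((e.cfg T').node j).ua .two).s2 = some true
    · exact hq _ _ (.outputOwn _ (ho T') hv' hwait hd.1 hd.2)
    · exact hq _ _ (.enterWait _ (ho T') hv' hwait hd)
  refine ⟨T', ?_⟩
  by_contra hcs
  rw [Bool.not_eq_true] at hcs
  refine hq _ _ (.correct _ (C.enc w j) (ho T') hwait hcs (hc.trans ?_))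
  rw [← Set.ncard_coe_finset L]
  exact Set.ncard_le_ncard (fun l hl => ⟨⟨_, (h1 l hl).1⟩, (h1 l hl).2⟩) (Set.toFinite _)

theorem exists_output (hk : 1 ≤ k) (hkt : 3 * k ≤ t) (hn : 3 * t + 1 ≤ n) (hF : F.card ≤ t)
    {w : Fin k → α} (hw : ∀ i ∉ F, ∀ T, (((e.cfg T).node i).ua .two).s2 = some true →
      (((e.cfg T).node i).ua .two).inp = some w)
    {L : Finset (Fin n)} (hc : t + 1 ≤ L.card) {T₀ : ℕ}
    (hL : ∀ j ∈ L, j ∉ F ∧ (((e.cfg T₀).node j).ua .two).s2 = some true)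
    (hv : ∀ j ∉ F, ∃ T, ((e.cfg T).node j).vOut = some true) (hj : j ∉ F) :
    ∃ T, ((e.cfg T).node j).output ≠ none := by
  classical
  by_contra! ho
  have hsym : ∀ l ∉ F, ∀ᶠ T in atTop, ((e.cfg T).node j).symFin l ≠ none ∨
      ((e.cfg T).node j).oecFin = true := by
    intro l hl
    obtain ⟨T₁, hT₁⟩ := hv l hl
    -- Either `l` runs forever and sends CORRECTSYMBOL, or the invariant on outputs shows which
    -- symbol it sent before stopping.
    by_cases hol : ∀ T, ((e.cfg T).node l).output = none
    · obtain ⟨T, hT⟩ := exists_correctSent hw hc hL hl hol hT₁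
      exact e.eventually_symFin_of_correctSent hl hj ho hT
    · push Not at hol
      obtain ⟨T, hT⟩ := hol
      obtain ⟨x, hx⟩ := Option.ne_none_iff_exists'.mp hT
      have hm := (e.ext l (le_max_left T T₁)).output _ hx
      have hvm := (e.ext l (le_max_right T T₁)).vOut _ hT₁
      rcases (e.nodeInv hk (by omega) l (max T T₁)).output x hm with
        ⟨-, h⟩ | ⟨-, ⟨h1, u, hu, -⟩ | ⟨h1, -⟩⟩
      · simp [hvm] at h
      · exact e.eventually_symFin_of_s2 hl hj ho hu h1
      · exact e.eventually_symFin_of_correctSent hl hj ho h1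
  obtain ⟨T₁, hT₁⟩ := hv j hj
  obtain ⟨T₂, hT₂⟩ := exists_correctSent hw hc hL hj ho hT₁
  have hall : ∀ᶠ T in atTop, ∀ l ∈ Fᶜ, ((e.cfg T).node j).symFin l ≠ none ∨
      ((e.cfg T).node j).oecFin = true :=
    (Finset.eventually_all _).mpr fun l hl => hsym l (Finset.mem_compl.mp hl)
  obtain ⟨T, ⟨h1, h2⟩, hq⟩ := e.exists_quiescent hj (hall.and (eventually_ge_atTop T₂))
  refine hq _ _ (.outputDecoded _ (ho T) ((e.ext j h2).correctSent hT₂) ?_)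
  -- Without success all honest symbols are present and correct, so the last attempt would have
  -- succeeded.
  by_contra hf
  refine (e.nodeInv hk (by omega) j T).oec_false (by simpa using hf)
    (oecSucceeds_of_symFin hkt hn hF (w := w) fun l hl => ?_)
  obtain ⟨y, hy⟩ := Option.ne_none_iff_exists'.mp
    ((h1 l (Finset.mem_compl.mpr hl)).resolve_right hf)
  rw [hy, symFin_eq hF hw hl hy]

theorem consistency (habba : ABBACorrect e) (hk : 1 ≤ k) (hkt : 3 * k ≤ t)
    (hn : 3 * t + 1 ≤ n) (hF : F.card ≤ t) {x : Option (Fin k → α)} (hi : i ∉ F) {T : ℕ}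
    (hout : ((e.cfg T).node i).output = some x) (hj : j ∉ F) :
    ∃ T', ((e.cfg T').node j).output = some x := by
  have htn : t < n := by omega
  obtain ⟨v, hv⟩ := exists_vOut_of_output hk htn (hout.trans_ne (Option.some_ne_none x))
  have hall := fun j (hj : j ∉ F) => exists_vOut habba hk hkt hn hF hi hv hj
  cases v with
  | false =>
    have none_of : ∀ {l}, l ∉ F → ∀ {S z}, ((e.cfg S).node l).vOut = some false →
        ((e.cfg S).node l).output = some z → z = none := by
      intro l hl S z h1 h2
      rcases (e.nodeInv hk htn l S).output z h2 with ⟨h, -⟩ | ⟨h, -⟩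
      · exact h
      · simp [h1] at h
    obtain ⟨T', hT'⟩ := hall j hj
    obtain ⟨z, hz⟩ := Option.ne_none_iff_exists'.mp ((e.nodeInv hk htn j T').halt hT')
    exact ⟨T', by rw [hz, none_of hj hT' hz, none_of hi hv hout]⟩
  | true =>
    obtain ⟨l, hl, S, hS⟩ := e.abbaOut_of_readySent hF T hi
      (readySent_of_vOut habba hk hkt hn hF hi hv)
    obtain ⟨i₀, -, h₀⟩ := habba.validity l hl S true hS
    obtain ⟨w, hw, L, hc, hL⟩ := exists_inp_of_s2 hk hkt hn hF h₀
    obtain ⟨T₁, hT₁⟩ := exists_output hk hkt hn hF hw hc hL hall hj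
    obtain ⟨z, hz⟩ := Option.ne_none_iff_exists'.mp hT₁
    obtain ⟨T₂, hT₂⟩ := hall j hj
    have hz' := (e.ext j (le_max_left T₁ T₂)).output _ hz
    have hv' := (e.ext j (le_max_right T₁ T₂)).vOut _ hT₂
    exact ⟨_, by rw [hz', output_eq hk htn hF hw hj hv' hz', output_eq hk htn hF hw hi hv hout]⟩

end Execution
end ACOOL

theorem theorem1 {n k t : ℕ} {α : Type*} (hk : 1 ≤ k) (hkt : 3 * k ≤ t) (hn : 3 * t + 1 ≤ n)
    (C : ACOOL.ErrorCorrectingCode n k α) (F : Finset (Fin n)) (hF : F.card ≤ t)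
    (e : ACOOL.Execution C t F) (habba : ACOOL.ABBACorrect e)
    (w : Option (Fin k → α)) (i : Fin n) (hi : i ∉ F) (T : ℕ)
    (hout : ((e.cfg T).node i).output = some w) :
    ∀ j ∉ F, ∃ T', ∀ T'' ≥ T', ((e.cfg T'').node j).output = some w := by
  intro j hj
  obtain ⟨T', h⟩ := ACOOL.Execution.consistency habba hk hkt hn hF hi hout hj
  exact ⟨T', fun T'' hT => (e.ext j hT).output _ h⟩
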